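/- All graphs are finite, simple and undirected, and all trees are nonempty. Let $G$ be a graph and $X\subseteq V(G)$. A set $D\subseteq V(G)$ is $X$-dominating if every vertex in $X\setminus D$ has a neighbor in $D$. For $g:V(G)\to\{0,1,2\}$ and distinct vertices $u,v$, let $g_{v\to u}$ be the function that takes the value $g(u)+1$ at $u$, $g(v)-1$ at $v$, and agrees with $g$ elsewhere. If $g(u)=0$, say that $u$ is defended by $g$ if $u$ has a neighbor $v$ with $g(v)\ge 1$ such that $\{x\in V(G): g_{v\to u}(x)\ge 1\}$ is $X$-dominating. A $(G,X)$-RDF is a function $f:V(G)\to\{0,1,2\}$ such that every $u\in X$ with $f(u)=0$ has a neighbor $v$ with $f(v)=2$. A $(G,X)$-WRDF is a function $g:V(G)\to\{0,1,2\}$ such that every $u\in X$ with $g(u)=0$ is defended by $g$. A $(G,X)$-WRDF is minimum if its weight $\sum_{x\in V(G)}g(x)$ is smallest among all $(G,X)$-WRDFs. The Roman domination number $\gamma_R(G)$ strongly equals the weak Roman domination number $\gamma_r(G)$ if every minimum $(G,V(G))$-WRDF is a $(G,V(G))$-RDF. Let $\mathcal S$ be the set of all triples $(T,X,Y)$ such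 that $T$ is a tree, $X,Y\subseteq V(T)$, every minimum $(T,X)$-WRDF is a $(T,X)$-RDF, and $Y$ is the set of all vertices $u$ for which there is a minimum $(T,X)$-WRDF $g$ such that either $g(u)\ge 1$, or $g(u)=0$ and $u$ is defended by $g$. Let $(T,X,Y)$ be such that $T$ is a tree and $X\subseteq Y\subseteq V(T)$. A triple $(T^+,X^+,Y^+)$ arises from $(T,X,Y)$ by * Operation 1, if for some vertex $u\notin Y$ of $T$, the tree $T^+$ arises from $T$ by adding a new vertex $v$ and the edge $uv$, $X^+=X$, and $Y^+=Y$; * Operation 2, if for some vertex $u\notin Y$ of $T$, the tree $T^+$ arises from $T$ by adding three new vertices $v,w_1,w_2$ and the edges $uv,vw_1,vw_2$, $X^+$ is $X\cup\{u,w_1,w_2\}$ or $X\cup\{u,v,w_1,w_2\}$, and $Y^+=Y\cup\{u,v,w_1,w_2\}$; * Operation 3, if for some vertex $u\notin X$ of $T$, the tree $T^+$ arises from $T$ by adding four new vertices $v,w_1,w_2,w_3$ and the edges $uv,vw_1,vw_2,vw_3$, $X^+=X\cup\{w_1,w_2,w_3\}\cup Z$ for some $Z\subseteq\{u,v\}$,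 and $Y^+=Y\cup\{u,v,w_1,w_2,w_3\}$. For the last two operations, call $(u,v,w_1,\ldots,w_k)$ a configuration of $(T,X,Y)$ if $v$ is a vertex of $T$ whose neighbors are the distinct vertices $u,w_1,\ldots,w_k$ and, with $W_i$ denoting the vertex set of the component of $T-v$ that contains $w_i$, there is some $\ell\in\{1,\ldots,k\}$ such that $W_i\cap X=\{w_i\}$ for $i\le\ell$, $W_i\cap X=\emptyset$ for $i>\ell$, $u,v\in Y$, $W_i\cap Y=\{w_i\}$ for all $i\in\{1,\ldots,k\}$, and either $\ell=2$ and $u\in X$, or $\ell\ge 3$. A triple $(T^+,X^+,Y^+)$ arises from $(T,X,Y)$ by * Operation 4, if for some configuration, $T^+$ arises from $T$ by adding a new vertex $v^*$ and the edge $vv^*$, $X^+$ is $X$ or $X\cup\{v^*\}$, and $Y^+=Y\cup\{v^*\}$; * Operation 5, if for some configuration and some $i\in\{1,\ldots,k\}$, $T^+$ arises from $T$ by adding a new vertex $v^*$ and the edge $w_iv^*$, $X^+=X$, and $Y^+=Y$. Let $\mathcal T$ be the set of all triples that can be obtained from (copies of) $(K_1,\emptyset,\emptyset)$ and $(K_1,V(K_1),V(K_1))$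 by finitely many (possibly zero) applications of Operations 1 to 5. Theorem. $\mathcal S=\mathcal T$. In particular, for a tree $T$, the Roman domination number of $T$ strongly equals the weak Roman domination number of $T$ if and only if $(T,V(T),V(T))\in\mathcal T$. -/

import Mathlib

universe u

namespace RomanTrees

open scoped Classical in
/-- The function `g_{v → u}`: one unit is moved from `v` to `u` (used for distinct `u`, `v`). -/
noncomputable def shift {V : Type u} (g : V → ℕ) (v u : V) : V → ℤ :=
  fun x => if x = u then (g u : ℤ) + 1 else if x = v then (g v : ℤ) - 1 else (g x : ℤ)

/-- `D` is `X`-dominating: every vertex in `X \ D` has a neighbor in `D`. -/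
def IsDominating {V : Type u} (G : SimpleGraph V) (X D : Set V) : Prop :=
  ∀ x ∈ X \ D, ∃ y ∈ D, G.Adj x y

/-- `u` has a neighbor `v` with `g v ≥ 1` such that `{x | g_{v → u} x ≥ 1}` is `X`-dominating. -/
def IsDefended {V : Type u} (G : SimpleGraph V) (X : Set V) (g : V → ℕ) (u : V) : Prop :=
  ∃ v, G.Adj u v ∧ 1 ≤ g v ∧ IsDominating G X {x | 1 ≤ shift g v u x}

/-- `f` is a Roman dominating function for `(G, X)`, with values in `{0, 1, 2}`. -/
def IsRDF {V : Type u} (G : SimpleGraph V) (X : Set V) (f : V → ℕ) : Prop :=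
  (∀ x, f x ∈ ({0, 1, 2} : Set ℕ)) ∧ ∀ u ∈ X, f u = 0 → ∃ v, G.Adj u v ∧ f v = 2

/-- `g` is a weak Roman dominating function for `(G, X)`, with values in `{0, 1, 2}`. -/
def IsWRDF {V : Type u} (G : SimpleGraph V) (X : Set V) (g : V → ℕ) : Prop :=
  (∀ x, g x ∈ ({0, 1, 2} : Set ℕ)) ∧ ∀ u ∈ X, g u = 0 → IsDefended G X g u

/-- The weight of a function on the vertices of a finite graph. -/
def weight {V : Type u} [Fintype V] (g : V → ℕ) : ℕ := ∑ x, g x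

/-- The weak Roman domination number of `(G, X)` (the constant function `1` is always a weak
Roman dominating function, so this is a minimum over a nonempty set). -/
noncomputable def weakRomanNumber {V : Type u} [Fintype V] (G : SimpleGraph V) (X : Set V) : ℕ :=
  sInf {n | ∃ g : V → ℕ, IsWRDF G X g ∧ weight g = n}

/-- `g` is a minimum weak Roman dominating function for `(G, X)`. -/
def IsMinWRDF {V : Type u} [Fintype V] (G : SimpleGraph V) (X : Set V) (g : V → ℕ) : Prop :=
  IsWRDF G X g ∧ weight g = weakRomanNumber G X

/-- The Roman domination number of `G` strongly equals the weak Roman domination number of `G`. -/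
def StronglyEqual {V : Type u} [Fintype V] (G : SimpleGraph V) : Prop :=
  ∀ g, IsMinWRDF G Set.univ g → IsRDF G Set.univ g

/-- A finite simple graph `T` together with two sets `X` and `Y` of its vertices. -/
structure Triple where
  /-- The vertex set. -/
  V : Type u
  /-- The vertex set is finite. -/
  fintypeV : Fintype V
  /-- The graph. -/
  T : SimpleGraph V
  /-- The first set of vertices. -/
  X : Set V
  /-- The second set of vertices. -/
  Y : Set V

attribute [instance] Triple.fintypeV

/-- The set `𝒮`. -/
def setS : Set Triple.{u} :=
  {A | A.T.IsTree ∧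
    (∀ g, IsMinWRDF A.T A.X g → IsRDF A.T A.X g) ∧
    A.Y = {u | ∃ g, IsMinWRDF A.T A.X g ∧ (1 ≤ g u ∨ (g u = 0 ∧ IsDefended A.T A.X g u))}}

/-- The standing assumption on triples to which an operation is applied. -/
def Triple.IsAdmissible (A : Triple.{u}) : Prop := A.T.IsTree ∧ A.X ⊆ A.Y

/-- Via the embedding `φ`, the graph `H` arises from `G` by adding the vertices in `N` as new
vertices and the edges in `E` as new edges. -/
def ArisesByAdding {V W : Type u} (G : SimpleGraph V) (H : SimpleGraph W) (φ : V ↪ W)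
    (N : Set W) (E : Set (Sym2 W)) : Prop :=
  (Set.range φ)ᶜ = N ∧ H.edgeSet = Sym2.map φ '' G.edgeSet ∪ E

/-- Operation 1: attach a new endvertex `v` to a vertex `u ∉ Y`. -/
def Op1 (A B : Triple.{u}) : Prop :=
  A.IsAdmissible ∧
  ∃ (φ : A.V ↪ B.V) (u : A.V) (v : B.V), u ∉ A.Y ∧
    ArisesByAdding A.T B.T φ {v} {s(φ u, v)} ∧
    B.X = φ '' A.X ∧
    B.Y = φ '' A.Y

/-- Operation 2: attach a star with center `v` and two leaves `w₁, w₂` to a vertex `u ∉ Y`. -/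
def Op2 (A B : Triple.{u}) : Prop :=
  A.IsAdmissible ∧
  ∃ (φ : A.V ↪ B.V) (u : A.V) (v w₁ w₂ : B.V), u ∉ A.Y ∧
    [v, w₁, w₂].Nodup ∧
    ArisesByAdding A.T B.T φ {v, w₁, w₂} {s(φ u, v), s(v, w₁), s(v, w₂)} ∧
    (B.X = φ '' A.X ∪ {φ u, w₁, w₂} ∨ B.X = φ '' A.X ∪ {φ u, v, w₁, w₂}) ∧
    B.Y = φ '' A.Y ∪ {φ u, v, w₁, w₂}

/-- Operation 3: attach a star with center `v` and three leaves `w₁, w₂, w₃` to a vertex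
`u ∉ X`. -/
def Op3 (A B : Triple.{u}) : Prop :=
  A.IsAdmissible ∧
  ∃ (φ : A.V ↪ B.V) (u : A.V) (v w₁ w₂ w₃ : B.V), u ∉ A.X ∧
    [v, w₁, w₂, w₃].Nodup ∧
    ArisesByAdding A.T B.T φ {v, w₁, w₂, w₃}
      {s(φ u, v), s(v, w₁), s(v, w₂), s(v, w₃)} ∧
    (B.X = φ '' A.X ∪ {w₁, w₂, w₃} ∨ B.X = φ '' A.X ∪ {φ u, w₁, w₂, w₃} ∨
      B.X = φ '' A.X ∪ {v, w₁, w₂, w₃} ∨ B.X = φ '' A.X ∪ {φ u, v, w₁, w₂, w₃}) ∧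
    B.Y = φ '' A.Y ∪ {φ u, v, w₁, w₂, w₃}

/-- For `w ≠ v`, the vertex set of the component of `T - v` that contains `w`. -/
def branch {V : Type u} (T : SimpleGraph V) (v w : V) : Set V :=
  {x | ∃ (hw : w ∈ ({v}ᶜ : Set V)) (hx : x ∈ ({v}ᶜ : Set V)),
    (T.induce ({v}ᶜ : Set V)).Reachable ⟨w, hw⟩ ⟨x, hx⟩}

/-- The configuration around `v` needed for Operations 4 and 5. The neighbors of `v` are
`u, w₁, …, w_k` (distinct; `w i` stands for `w_{i+1}`), and `W_i` is the vertex set of the component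
of `T - v` that contains `w_i`. For some `ℓ ∈ {1, …, k}`, we have `W_i ∩ X = {w_i}` for `i ≤ ℓ` and
`W_i ∩ X = ∅` for `i > ℓ`. Moreover, `u, v ∈ Y`, `W_i ∩ Y = {w_i}` for all `i`, and either `ℓ = 2`
and `u ∈ X`, or `ℓ ≥ 3`. -/
def Triple.IsConfiguration (A : Triple.{u}) (u v : A.V) (k : ℕ) (w : Fin k → A.V) : Prop :=
  Function.Injective w ∧ u ∉ Set.range w ∧
  A.T.neighborSet v = {u} ∪ Set.range w ∧
  ∃ ℓ : ℕ, 1 ≤ ℓ ∧ ℓ ≤ k ∧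
    (∀ i : Fin k, (i : ℕ) < ℓ → branch A.T v (w i) ∩ A.X = {w i}) ∧
    (∀ i : Fin k, ℓ ≤ (i : ℕ) → branch A.T v (w i) ∩ A.X = ∅) ∧
    ((ℓ = 2 ∧ u ∈ A.X ∧ u ∈ A.Y ∧ v ∈ A.Y ∧ ∀ i, branch A.T v (w i) ∩ A.Y = {w i}) ∨
      (3 ≤ ℓ ∧ u ∈ A.Y ∧ v ∈ A.Y ∧ ∀ i, branch A.T v (w i) ∩ A.Y = {w i}))

/-- Operation 4: attach a new endvertex `z` to the vertex `v` of a configuration. -/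
def Op4 (A B : Triple.{u}) : Prop :=
  A.IsAdmissible ∧
  ∃ (φ : A.V ↪ B.V) (u v : A.V) (k : ℕ) (w : Fin k → A.V) (z : B.V),
    A.IsConfiguration u v k w ∧
    ArisesByAdding A.T B.T φ {z} {s(φ v, z)} ∧
    (B.X = φ '' A.X ∨ B.X = φ '' A.X ∪ {z}) ∧
    B.Y = φ '' A.Y ∪ {z}

/-- Operation 5: attach a new endvertex `z` to one of the vertices `w_i` of a configuration. -/
def Op5 (A B : Triple.{u}) : Prop :=
  A.IsAdmissible ∧
  ∃ (φ : A.V ↪ B.V) (u v : A.V) (k : ℕ) (w : Fin k → A.V) (i : Fin k) (z : B.V),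
    A.IsConfiguration u v k w ∧
    ArisesByAdding A.T B.T φ {z} {s(φ (w i), z)} ∧
    B.X = φ '' A.X ∧
    B.Y = φ '' A.Y

/-- Membership in `𝒯`: the triples generated from `(K₁, ∅, ∅)` and `(K₁, V(K₁), V(K₁))` by the five
operations. (A simple graph with exactly one vertex is a copy of `K₁`.) -/
inductive Generated : Triple.{u} → Prop
  | base_empty (A : Triple.{u}) (hV : Fintype.card A.V = 1) (hX : A.X = ∅) (hY : A.Y = ∅) :
      Generated A
  | base_full (A : Triple.{u}) (hV : Fintype.card A.V = 1) (hX : A.X = Set.univ)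
      (hY : A.Y = Set.univ) : Generated A
  | step (A B : Triple.{u}) (hA : Generated A)
      (hAB : Op1 A B ∨ Op2 A B ∨ Op3 A B ∨ Op4 A B ∨ Op5 A B) : Generated B

/-- The set `𝒯`. -/
def setT : Set Triple.{u} := {A | Generated A}

end RomanTrees

/-!
The engine is an exchange argument: if every minimum weak Roman dominating function is Roman, then a
vertex of value `2` in such a function has three private neighbors, since with at most two of them
one of its two units could be dropped, or moved to one of them, which keeps the weak property but
destroys the Roman one. Consequently, if all demands in the component of `T - u` at a neighbor `v`
of `u` lie in the closed neighborhood of `v`, and some of them are neighbors of `v`, then every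
minimum function is `2` at `v` and `0` on the rest of that component. Such vertices `v` are the ones
around which there is a configuration.

With this rigidity, minimum functions restrict and extend along each of the five operations, so the
operations preserve `𝒮`. Conversely, a smallest component of the form above that contains demands
has such a center `v`, and the tree shrinks within `𝒮` by losing an endvertex there, or the whole
star centered at `v` when the component is a star with exactly two or three endvertices, all of them
in `X`.
-/

namespace RomanTrees

section Basic

variable {V : Type*} {G : SimpleGraph V} {X : Set V} {g : V → ℕ} {u v : V}

lemma one_le_shift_iff (huv : u ≠ v) {y : V} :
    1 ≤ shift g v u y ↔ y = u ∨ 1 ≤ g y ∧ (y = v → 2 ≤ g v) := by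
  simp only [shift]
  split_ifs with hu hv
  · simp [hu]
  · subst hv
    simp only [huv.symm, false_or, forall_const]
    omega
  · simp [hu, hv]

lemma isDominating_iff {D : Set V} :
    IsDominating G X D ↔ ∀ x ∈ X, ∃ y ∈ D, y = x ∨ G.Adj x y := by
  refine ⟨fun h x hx => ?_, fun h x ⟨hx, hxD⟩ => ?_⟩
  · by_cases hxD : x ∈ D
    · exact ⟨x, hxD, Or.inl rfl⟩
    · obtain ⟨y, hy, hxy⟩ := h x ⟨hx, hxD⟩
      exact ⟨y, hy, Or.inr hxy⟩
  · obtain ⟨y, hy, rfl | hxy⟩ := h x hx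
    · exact absurd hy hxD
    · exact ⟨y, hy, hxy⟩

/-- The neighbor `v` defends `u`: the support left by moving one unit from `v` to `u` is
`X`-dominating. The support is spelled out in `ℕ`, avoiding the integer-valued `shift`. -/
def Defends (G : SimpleGraph V) (X : Set V) (g : V → ℕ) (u v : V) : Prop :=
  G.Adj u v ∧ 1 ≤ g v ∧
    ∀ x ∈ X, ∃ y, (y = x ∨ G.Adj x y) ∧ (y = u ∨ 1 ≤ g y ∧ (y = v → 2 ≤ g v))

lemma isDefended_iff : IsDefended G X g u ↔ ∃ v, Defends G X g u v := by
  refine exists_congr fun v => and_congr_right fun huv => and_congr_right fun _ => ?_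
  simp only [isDominating_iff, Set.mem_ofPred_eq, one_le_shift_iff huv.ne, and_comm]

lemma Defends.of_forall_zero (huv : G.Adj u v) (hv : 1 ≤ g v)
    (h : ∀ x ∈ X, g x = 0 → ∃ y, (y = x ∨ G.Adj x y) ∧ (y = u ∨ 1 ≤ g y ∧ (y = v → 2 ≤ g v))) :
    Defends G X g u v := by
  refine ⟨huv, hv, fun x hx => ?_⟩
  by_cases hx0 : g x = 0
  · exact h x hx hx0
  · by_cases hxv : x = v
    · exact ⟨u, Or.inr (hxv ▸ huv.symm), Or.inl rfl⟩
    · exact ⟨x, Or.inl rfl, Or.inr ⟨by omega, fun h => absurd h hxv⟩⟩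

lemma mem_zero_one_two_iff {n : ℕ} : n ∈ ({0, 1, 2} : Set ℕ) ↔ n ≤ 2 := by
  simp only [Set.mem_insert_iff, Set.mem_singleton_iff]
  omega

lemma IsWRDF.le_two (h : IsWRDF G X g) (x : V) : g x ≤ 2 := mem_zero_one_two_iff.1 (h.1 x)

lemma IsWRDF.exists_adj_pos (h : IsWRDF G X g) {x : V} (hx : x ∈ X) (hx0 : g x = 0) :
    ∃ y, G.Adj x y ∧ 1 ≤ g y :=
  let ⟨y, hxy, hy, _⟩ := h.2 x hx hx0
  ⟨y, hxy, hy⟩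

lemma isDefended_of_adj_two (huv : G.Adj u v) (hv : g v = 2)
    (hdom : ∀ x ∈ X, g x = 0 → ∃ y, G.Adj x y ∧ 1 ≤ g y) : IsDefended G X g u := by
  refine isDefended_iff.2 ⟨v, .of_forall_zero huv (by omega) fun x hx hx0 => ?_⟩
  obtain ⟨y, hxy, hy⟩ := hdom x hx hx0
  exact ⟨y, Or.inr hxy, Or.inr ⟨hy, fun _ => hv.ge⟩⟩

lemma IsRDF.isWRDF (h : IsRDF G X g) : IsWRDF G X g := by
  refine ⟨h.1, fun u hu hu0 => ?_⟩
  obtain ⟨v, huv, hv⟩ := h.2 u hu hu0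
  refine isDefended_of_adj_two huv hv fun x hx hx0 => ?_
  obtain ⟨y, hxy, hy⟩ := h.2 x hx hx0
  exact ⟨y, hxy, by omega⟩

lemma isWRDF_one (G : SimpleGraph V) (X : Set V) : IsWRDF G X fun _ => 1 :=
  ⟨fun _ => by simp, fun _ _ h => absurd h one_ne_zero⟩

/-- The private neighbors of `v` under `g`: the zero vertices in `X` whose only positive neighbor
is `v`. They limit how far the value at `v` can be lowered. -/
def IsPrivate (G : SimpleGraph V) (X : Set V) (g : V → ℕ) (v x : V) : Prop :=
  x ∈ X ∧ G.Adj x v ∧ g x = 0 ∧ ∀ y, G.Adj x y → y ≠ v → g y = 0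

lemma Defends.two_le_of_isPrivate {w : V} (hd : Defends G X g u v) (hw : IsPrivate G X g v w)
    (huw : u ≠ w) (hadj : ¬ G.Adj w u) : 2 ≤ g v := by
  obtain ⟨hwX, -, hw0, hwN⟩ := hw
  obtain ⟨y, hwy, hy⟩ := hd.2.2 w hwX
  obtain rfl | hwy := hwy
  · rcases hy with rfl | hy
    · exact absurd rfl huw
    · omega
  · obtain rfl | ⟨hy, hyv⟩ := hy
    · exact absurd hwy hadj
    · refine hyv ?_
      by_contra hne
      have := hwN y hwy hne
      omega

lemma IsWRDF.defends_of_isPrivate (hW : IsWRDF G X g) {a : V} (ha : IsPrivate G X g v a) :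
    Defends G X g a v := by
  obtain ⟨y, hy⟩ := isDefended_iff.1 (hW.2 a ha.1 ha.2.2.1)
  obtain rfl : y = v := by
    by_contra hne
    have := ha.2.2.2 y hy.1 hne
    have := hy.2.1
    omega
  exact hy

lemma IsWRDF.two_le_of_isPrivate (hW : IsWRDF G X g) {a b : V} (ha : IsPrivate G X g v a)
    (hb : IsPrivate G X g v b) (hab : a ≠ b) (hadj : ¬ G.Adj b a) : 2 ≤ g v :=
  (hW.defends_of_isPrivate ha).two_le_of_isPrivate hb hab hadj

lemma IsRDF.exists_adj_pos_ne (hR : IsRDF G X g) {x : V} (hx : x ∈ X) (hx0 : g x = 0)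
    (hP : ¬ IsPrivate G X g v x) : ∃ y, G.Adj x y ∧ 1 ≤ g y ∧ y ≠ v := by
  by_contra! hcon
  obtain ⟨y, hxy, hy⟩ := hR.2 x hx hx0
  obtain rfl := hcon y hxy (by omega)
  refine hP ⟨hx, hxy, hx0, fun z hxz hzy => ?_⟩
  by_contra hz
  exact hzy (hcon z hxz (by omega))

/-- The one private neighbor `b` that is still zero may safely be defended by `v` itself. -/
lemma IsRDF.isWRDF_of_lower (hR : IsRDF G X g) {h : V → ℕ} {b : V} (hh : ∀ x, h x ≤ 2)
    (hv : 1 ≤ h v) (hle : ∀ x, x ≠ v → g x ≤ h x)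
    (hP : ∀ x, IsPrivate G X g v x → h x = 0 → x = b) : IsWRDF G X h := by
  have hpos : ∀ {y}, 1 ≤ g y → 1 ≤ h y := fun {y} hy => by
    rcases eq_or_ne y v with rfl | hne
    · exact hv
    · exact hy.trans (hle y hne)
  have hzero : ∀ {x}, h x = 0 → g x = 0 := fun {x} hx => by
    by_contra hne
    have := hpos (y := x) (by omega)
    omega
  have hother : ∀ x ∈ X, h x = 0 → x = b ∨ ∃ y, G.Adj x y ∧ 1 ≤ h y ∧ y ≠ v := by
    intro x hx hx0
    by_cases hxP : IsPrivate G X g v x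
    · exact Or.inl (hP x hxP hx0)
    · obtain ⟨y, hxy, hy, hyv⟩ := hR.exists_adj_pos_ne hx (hzero hx0) hxP
      exact Or.inr ⟨y, hxy, hpos hy, hyv⟩
  refine ⟨fun x => mem_zero_one_two_iff.2 (hh x), fun x hx hx0 => isDefended_iff.2 ?_⟩
  obtain ⟨y, hxy, hy⟩ := hR.2 x hx (hzero hx0)
  obtain rfl | ⟨z, hxz, hz, hzv⟩ := hother x hx hx0
  · refine ⟨y, .of_forall_zero hxy (hpos (by omega)) fun q hq hq0 => ?_⟩
    by_cases hyv : y = v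
    · subst hyv
      obtain rfl | ⟨t, hqt, ht, hty⟩ := hother q hq hq0
      · exact ⟨q, Or.inl rfl, Or.inl rfl⟩
      · exact ⟨t, Or.inr hqt, Or.inr ⟨ht, fun h => absurd h hty⟩⟩
    · obtain ⟨t, hqt, ht⟩ := hR.2 q hq (hzero hq0)
      exact ⟨t, Or.inr hqt, Or.inr ⟨hpos (by omega), fun _ => hy ▸ hle y hyv⟩⟩
  · refine ⟨z, .of_forall_zero hxz hz fun q hq hq0 => ?_⟩
    obtain ⟨t, hqt, ht⟩ := hR.2 q hq (hzero hq0)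
    exact ⟨t, Or.inr hqt, Or.inr ⟨hpos (by omega), by rintro rfl; exact ht ▸ hle t hzv⟩⟩

lemma IsRDF.isWRDF_update_update [DecidableEq V] (hR : IsRDF G X g) {a b : V} (ha : a ≠ v)
    (hP : ∀ x, IsPrivate G X g v x → x ≠ a → x = b) (ha0 : g a = 0) :
    IsWRDF G X (Function.update (Function.update g v 1) a 1) := by
  refine hR.isWRDF_of_lower (v := v) (b := b) (fun x => ?_) ?_ (fun x hx => ?_) fun x hx hx0 =>
    hP x hx (by rintro rfl; simp at hx0)
  · have := hR.isWRDF.le_two x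
    simp only [Function.update_apply]
    split_ifs <;> omega
  · simp [Function.update_of_ne ha.symm]
  · simp only [Function.update_apply, if_neg hx]
    split_ifs with hxa
    · simp [hxa, ha0]
    · rfl

lemma IsRDF.isWRDF_move [DecidableEq V] (hR : IsRDF G X g) (huv : G.Adj u v) (hu : g u ≠ 2)
    (hv : g v ≠ 2) : IsWRDF G X (Function.update (Function.update g u 0) v 1) := by
  set h := Function.update (Function.update g u 0) v 1 with hdef
  have hhv : h v = 1 := by simp [hdef]
  have hother : ∀ x, x ≠ u → x ≠ v → h x = g x := fun x hxu hxv => by simp [hdef, hxu, hxv]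
  have htwo : ∀ x ∈ X, h x = 0 → x = u ∨ ∃ y, G.Adj x y ∧ h y = 2 := fun x hx hx0 => by
    by_cases hxu : x = u
    · exact Or.inl hxu
    · obtain ⟨y, hxy, hy⟩ := hR.2 x hx (by rwa [← hother x hxu (by rintro rfl; omega)])
      exact Or.inr ⟨y, hxy, by rwa [hother y (by rintro rfl; omega) (by rintro rfl; omega)]⟩
  have hd : Defends G X h u v := .of_forall_zero huv hhv.ge fun x hx hx0 => by
    obtain rfl | ⟨y, hxy, hy⟩ := htwo x hx hx0
    · exact ⟨x, Or.inl rfl, Or.inl rfl⟩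
    · exact ⟨y, Or.inr hxy, Or.inr ⟨by omega, by rintro rfl; omega⟩⟩
  refine ⟨fun x => mem_zero_one_two_iff.2 ?_, fun x hx hx0 => ?_⟩
  · have := hR.isWRDF.le_two x
    simp only [hdef, Function.update_apply]
    split_ifs <;> omega
  · obtain rfl | ⟨y, hxy, hy⟩ := htwo x hx hx0
    · exact isDefended_iff.2 ⟨v, hd⟩
    · refine isDefended_of_adj_two hxy hy fun q hq hq0 => ?_
      obtain rfl | ⟨z, hqz, hz⟩ := htwo q hq hq0
      · exact ⟨v, huv, hhv.ge⟩
      · exact ⟨z, hqz, by omega⟩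

end Basic

section Minimum

variable {V : Type*} [Fintype V] {G : SimpleGraph V} {X : Set V} {g h : V → ℕ} {u v : V}

lemma exists_isMinWRDF (G : SimpleGraph V) (X : Set V) : ∃ g, IsMinWRDF G X g :=
  Nat.sInf_mem (s := {n | ∃ g : V → ℕ, IsWRDF G X g ∧ weight g = n}) ⟨_, _, isWRDF_one G X, rfl⟩

lemma IsMinWRDF.weight_le (hg : IsMinWRDF G X g) (hh : IsWRDF G X h) : weight g ≤ weight h :=
  hg.2.trans_le (Nat.sInf_le ⟨h, hh, rfl⟩)

lemma IsMinWRDF.of_weight_le (hg : IsMinWRDF G X g) (hh : IsWRDF G X h)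
    (hw : weight h ≤ weight g) : IsMinWRDF G X h :=
  ⟨hh, (hw.trans_eq hg.2).antisymm (Nat.sInf_le ⟨h, hh, rfl⟩)⟩

lemma IsWRDF.isMinWRDF (hg : IsWRDF G X g) (hmin : ∀ h, IsWRDF G X h → weight g ≤ weight h) :
    IsMinWRDF G X g :=
  let ⟨k, hk⟩ := exists_isMinWRDF G X
  hk.of_weight_le hg (hmin k hk.1)

lemma weight_update [DecidableEq V] (g : V → ℕ) (a : V) (n : ℕ) :
    weight (Function.update g a n) + g a = weight g + n := by
  rw [weight, weight, Finset.sum_update_of_mem (Finset.mem_univ a), Finset.sdiff_singleton_eq_erase,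
    ← Finset.add_sum_erase _ g (Finset.mem_univ a)]
  omega

/-- Every minimum `(G, X)`-WRDF is a `(G, X)`-RDF: the condition on `(T, X)` in the definition
of `𝒮`. -/
def Strong (G : SimpleGraph V) (X : Set V) : Prop := ∀ g, IsMinWRDF G X g → IsRDF G X g

/-- The vertices that are positive or defended under some minimum `(G, X)`-WRDF: the set `Y` in the
definition of `𝒮`. -/
def coverable (G : SimpleGraph V) (X : Set V) : Set V :=
  {u | ∃ g, IsMinWRDF G X g ∧ (1 ≤ g u ∨ (g u = 0 ∧ IsDefended G X g u))}

lemma subset_coverable (G : SimpleGraph V) (X : Set V) : X ⊆ coverable G X := by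
  intro x hx
  obtain ⟨g, hg⟩ := exists_isMinWRDF G X
  refine ⟨g, hg, (Nat.eq_zero_or_pos (g x)).elim (fun h0 => Or.inr ⟨h0, hg.1.2 x hx h0⟩) Or.inl⟩

lemma mem_coverable_of_adj_two (hg : IsMinWRDF G X g) (huv : G.Adj u v) (hv : g v = 2) :
    u ∈ coverable G X :=
  ⟨g, hg, (Nat.eq_zero_or_pos (g u)).elim
    (fun h0 => Or.inr ⟨h0, isDefended_of_adj_two huv hv fun _ => hg.1.exists_adj_pos⟩) Or.inl⟩

lemma apply_eq_zero_of_notMem_coverable (hg : IsMinWRDF G X g) (hu : u ∉ coverable G X) :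
    g u = 0 := by
  by_contra h0
  exact hu ⟨g, hg, Or.inl (by omega)⟩

lemma IsMinWRDF.not_isRDF_update_zero [DecidableEq V] (hg : IsMinWRDF G X g) (hv : 1 ≤ g v) :
    ¬ IsRDF G X (Function.update g v 0) := fun hR => by
  have hle := hg.weight_le hR.isWRDF
  have hw := weight_update g v 0
  omega

lemma IsMinWRDF.mem_and_forall_ne_two_of_eq_one (hg : IsMinWRDF G X g) (hR : IsRDF G X g)
    (hv : g v = 1) : v ∈ X ∧ ∀ y, G.Adj v y → g y ≠ 2 := by
  classical
  by_contra hcon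
  refine hg.not_isRDF_update_zero hv.ge ⟨fun x => ?_, fun x hx hx0 => ?_⟩
  · rcases eq_or_ne x v with rfl | h
    · simp
    · simpa only [Function.update_of_ne h] using hR.1 x
  · obtain ⟨y, hxy, hy⟩ : ∃ y, G.Adj x y ∧ g y = 2 := by
      rcases eq_or_ne x v with rfl | h
      · simpa [hx] using hcon
      · exact hR.2 x hx (by rwa [Function.update_of_ne h] at hx0)
    exact ⟨y, hxy, by rwa [Function.update_of_ne (by rintro rfl; omega)]⟩

/-- Otherwise moving the unit from `u` to `v` would give a minimum `(G, X)`-WRDF that is not Roman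
dominating at `u`. -/
lemma Strong.apply_ne_zero_of_adj (hS : Strong G X) (hg : IsMinWRDF G X g) (huv : G.Adj u v)
    (hu : g u = 1) : g v ≠ 0 := fun hv => by
  classical
  obtain ⟨huX, hN⟩ := hg.mem_and_forall_ne_two_of_eq_one (hS g hg) hu
  have hw := weight_update g u 0
  have hw' := weight_update (Function.update g u 0) v 1
  rw [Function.update_of_ne huv.ne', hv] at hw'
  have hmin := hg.of_weight_le ((hS g hg).isWRDF_move huv (by omega) (by omega)) (by omega)
  obtain ⟨y, huy, hy⟩ := (hS _ hmin).2 u huX (by simp [huv.ne])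
  have hyv : y ≠ v := by rintro rfl; simp at hy
  rw [Function.update_of_ne hyv, Function.update_of_ne huy.ne'] at hy
  exact hN y huy hy

lemma IsMinWRDF.exists_isPrivate_ne (hg : IsMinWRDF G X g) (hR : IsRDF G X g) (hv : g v = 2)
    (b : V) : ∃ x, IsPrivate G X g v x ∧ x ≠ b := by
  classical
  by_contra! hcon
  have hW : IsWRDF G X (Function.update g v 1) := by
    refine hR.isWRDF_of_lower (v := v) (b := b) (fun x => ?_) (by simp) (fun x hx => ?_)
      fun x hx _ => hcon x hx
    · rcases eq_or_ne x v with rfl | h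
      · simp
      · simpa only [Function.update_of_ne h] using hg.1.le_two x
    · rw [Function.update_of_ne hx]
  have hle := hg.weight_le hW
  have hw := weight_update g v 1
  omega

/-- If the private neighbors of `v` were just `a` and `b`, moving a unit from `v` to `a` would give
a minimum `(G, X)`-WRDF that is not Roman dominating at `b`. -/
lemma Strong.exists_isPrivate (hS : Strong G X) (hg : IsMinWRDF G X g) (hv : g v = 2)
    (a b : V) : ∃ x, IsPrivate G X g v x ∧ x ≠ a ∧ x ≠ b := by
  classical
  by_contra! hcon
  have hR := hS g hg
  obtain ⟨b', hb, hba⟩ := hg.exists_isPrivate_ne hR hv a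
  obtain rfl := hcon b' hb hba
  obtain ⟨a', ha, hab⟩ := hg.exists_isPrivate_ne hR hv b'
  obtain rfl : a' = a := by
    by_contra hne
    exact hab (hcon a' ha hne)
  have hav : a' ≠ v := ha.2.1.ne
  have hw := weight_update g v 1
  have hw' := weight_update (Function.update g v 1) a' 1
  rw [Function.update_of_ne hav, ha.2.2.1] at hw'
  have hmin := hg.of_weight_le (hR.isWRDF_update_update hav hcon ha.2.2.1) (by omega)
  obtain ⟨y, hby, hy⟩ := (hS _ hmin).2 b' hb.1
    (by rw [Function.update_of_ne hba, Function.update_of_ne hb.2.1.ne, hb.2.2.1])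
  have hya : y ≠ a' := by rintro rfl; simp at hy
  have hyv : y ≠ v := by rintro rfl; simp [hya] at hy
  rw [Function.update_of_ne hya, Function.update_of_ne hyv, hb.2.2.2 y hby hyv] at hy
  exact absurd hy two_ne_zero.symm

end Minimum

section Pendant

variable {V W : Type*} {G : SimpleGraph V} {H : SimpleGraph W} {φ : V ↪ W} {u : V} {v : W}
  {X : Set V} {X' : Set W} {h : W → ℕ}

/-- `H` arises from `G`, embedded by `φ`, by attaching a graph that contains `v` through the single
edge between `φ u` and `v`. -/
structure PendantExt (G : SimpleGraph V) (H : SimpleGraph W) (φ : V ↪ W) (u : V) (v : W) :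
    Prop where
  adj_iff : ∀ a b, H.Adj (φ a) (φ b) ↔ G.Adj a b
  adj_new_iff : ∀ a x, x ∉ Set.range φ → (H.Adj (φ a) x ↔ a = u ∧ x = v)
  notMem : v ∉ Set.range φ

lemma PendantExt.adj (P : PendantExt G H φ u v) : H.Adj (φ u) v :=
  (P.adj_new_iff u v P.notMem).2 ⟨rfl, rfl⟩

/-- The members of `X'` that do not come from `X` are covered by new vertices of value `2`. This
makes `h` behave on `G` as on `H`. -/
def CoveredOutside (H : SimpleGraph W) (φ : V ↪ W) (X : Set V) (X' : Set W) (h : W → ℕ) : Prop :=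
  ∀ p ∈ X', p ∉ φ '' X → ∃ y ∉ Set.range φ, (y = p ∨ H.Adj p y) ∧ h y = 2

lemma coveredOutside_image : CoveredOutside H φ X (φ '' X) h := fun _ hp hp' => absurd hp hp'

lemma PendantExt.defends_comp (P : PendantExt G H φ u v) (hX : φ '' X ⊆ X')
    (hc : h v = 0 ∨ u ∉ X) {x b : V} (hd : Defends H X' h (φ x) (φ b)) :
    Defends G X (h ∘ φ) x b := by
  obtain ⟨hxb, hb, hdom⟩ := hd
  refine ⟨(P.adj_iff _ _).1 hxb, hb, fun q hq => ?_⟩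
  obtain ⟨y, hqy, hy⟩ := hdom (φ q) (hX ⟨q, hq, rfl⟩)
  by_cases hyr : y ∈ Set.range φ
  · obtain ⟨y, rfl⟩ := hyr
    exact ⟨y, by simpa [P.adj_iff] using hqy, by simpa using hy⟩
  · exfalso
    rcases hqy with rfl | hqy
    · exact hyr ⟨q, rfl⟩
    · obtain ⟨rfl, rfl⟩ := (P.adj_new_iff q y hyr).1 hqy
      have hpos := (hy.resolve_left (by rintro rfl; exact hyr ⟨x, rfl⟩)).1
      exact hc.elim (by omega) fun hqX => hqX hq

lemma PendantExt.defends_of_comp (P : PendantExt G H φ u v) (hout : CoveredOutside H φ X X' h)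
    {x b : V} (hd : Defends G X (h ∘ φ) x b) : Defends H X' h (φ x) (φ b) := by
  obtain ⟨hxb, hb, hdom⟩ := hd
  refine ⟨(P.adj_iff _ _).2 hxb, hb, fun q hq => ?_⟩
  by_cases hqX : q ∈ φ '' X
  · obtain ⟨q, hqX, rfl⟩ := hqX
    obtain ⟨y, hqy, hy⟩ := hdom q hqX
    exact ⟨φ y, by simpa [P.adj_iff] using hqy, by simpa using hy⟩
  · obtain ⟨y, hyr, hqy, hy⟩ := hout q hq hqX
    exact ⟨y, hqy, Or.inr ⟨by omega, by rintro rfl; exact absurd ⟨b, rfl⟩ hyr⟩⟩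

lemma PendantExt.isDefended_comp (P : PendantExt G H φ u v) (hX : φ '' X ⊆ X') {x : V}
    (hc : h v = 0 ∨ u ∉ X ∧ x ≠ u) (hd : IsDefended H X' h (φ x)) : IsDefended G X (h ∘ φ) x := by
  obtain ⟨y, hy⟩ := isDefended_iff.1 hd
  by_cases hyr : y ∈ Set.range φ
  · obtain ⟨b, rfl⟩ := hyr
    exact isDefended_iff.2 ⟨b, P.defends_comp hX (hc.imp_right And.left) hy⟩
  · obtain ⟨rfl, rfl⟩ := (P.adj_new_iff x y hyr).1 hy.1
    exact hc.elim (fun h0 => absurd hy.2.1 (by omega)) fun hx => absurd rfl hx.2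

lemma PendantExt.isDefended_apply_iff (P : PendantExt G H φ u v) (hX : φ '' X ⊆ X')
    (hout : CoveredOutside H φ X X' h) {x : V} (hc : h v = 0 ∨ u ∉ X ∧ x ≠ u) :
    IsDefended H X' h (φ x) ↔ IsDefended G X (h ∘ φ) x := by
  refine ⟨P.isDefended_comp hX hc, fun hd => ?_⟩
  obtain ⟨b, hb⟩ := isDefended_iff.1 hd
  exact isDefended_iff.2 ⟨φ b, P.defends_of_comp hout hb⟩

lemma PendantExt.isWRDF_comp (P : PendantExt G H φ u v) (hX : φ '' X ⊆ X')
    (hc : h v = 0 ∨ u ∉ X) (hh : IsWRDF H X' h) : IsWRDF G X (h ∘ φ) :=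
  ⟨fun _ => hh.1 _, fun x hx hx0 => P.isDefended_comp hX
    (hc.imp_right fun hu => ⟨hu, ne_of_mem_of_not_mem hx hu⟩) (hh.2 (φ x) (hX ⟨x, hx, rfl⟩) hx0)⟩

lemma PendantExt.isRDF_comp (P : PendantExt G H φ u v) (hX : φ '' X ⊆ X')
    (hc : h v = 0 ∨ u ∉ X) (hh : IsRDF H X' h) : IsRDF G X (h ∘ φ) := by
  refine ⟨fun _ => hh.1 _, fun x hx hx0 => ?_⟩
  obtain ⟨y, hxy, hy⟩ := hh.2 (φ x) (hX ⟨x, hx, rfl⟩) hx0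
  by_cases hyr : y ∈ Set.range φ
  · obtain ⟨b, rfl⟩ := hyr
    exact ⟨b, (P.adj_iff _ _).1 hxy, hy⟩
  · obtain ⟨rfl, rfl⟩ := (P.adj_new_iff x y hyr).1 hxy
    exact hc.elim (by omega) fun hxX => absurd hx hxX

lemma PendantExt.isRDF_of_comp (P : PendantExt G H φ u v) (hout : CoveredOutside H φ X X' h)
    (hle : ∀ x ∉ Set.range φ, h x ≤ 2) (hg : IsRDF G X (h ∘ φ)) : IsRDF H X' h := by
  refine ⟨fun x => ?_, fun x hx hx0 => ?_⟩
  · by_cases hxr : x ∈ Set.range φ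
    · obtain ⟨a, rfl⟩ := hxr
      exact hg.1 a
    · exact mem_zero_one_two_iff.2 (hle x hxr)
  · by_cases hxX : x ∈ φ '' X
    · obtain ⟨x, hxX, rfl⟩ := hxX
      obtain ⟨y, hxy, hy⟩ := hg.2 x hxX hx0
      exact ⟨φ y, (P.adj_iff _ _).2 hxy, hy⟩
    · obtain ⟨y, -, rfl | hxy, hy⟩ := hout x hx hxX
      · omega
      · exact ⟨y, hxy, hy⟩

lemma PendantExt.isWRDF_of_comp (P : PendantExt G H φ u v) (hout : CoveredOutside H φ X X' h)
    (hle : ∀ x ∉ Set.range φ, h x ≤ 2) (hg : IsWRDF G X (h ∘ φ)) : IsWRDF H X' h := by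
  have hnew : ∀ p ∈ X', p ∉ φ '' X → h p = 0 → ∃ y, H.Adj p y ∧ h y = 2 := fun p hp hpX hp0 => by
    obtain ⟨y, -, rfl | hpy, hy⟩ := hout p hp hpX
    · omega
    · exact ⟨y, hpy, hy⟩
  refine ⟨fun x => ?_, fun x hx hx0 => ?_⟩
  · by_cases hxr : x ∈ Set.range φ
    · obtain ⟨a, rfl⟩ := hxr
      exact hg.1 a
    · exact mem_zero_one_two_iff.2 (hle x hxr)
  · by_cases hxX : x ∈ φ '' X
    · obtain ⟨x, hxX, rfl⟩ := hxX
      obtain ⟨b, hb⟩ := isDefended_iff.1 (hg.2 x hxX hx0)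
      exact isDefended_iff.2 ⟨φ b, P.defends_of_comp hout hb⟩
    · obtain ⟨y, hxy, hy⟩ := hnew x hx hxX hx0
      refine isDefended_of_adj_two hxy hy fun q hq hq0 => ?_
      by_cases hqX : q ∈ φ '' X
      · obtain ⟨q, hqX, rfl⟩ := hqX
        obtain ⟨t, hqt, ht⟩ := hg.exists_adj_pos hqX hq0
        exact ⟨φ t, (P.adj_iff _ _).2 hqt, ht⟩
      · obtain ⟨t, hqt, ht⟩ := hnew q hq hqX hq0
        exact ⟨t, hqt, by omega⟩

open scoped Classical in
lemma weight_eq_comp_add [Fintype V] [Fintype W] (φ : V ↪ W) (h : W → ℕ) :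
    weight h = weight (h ∘ φ) + ∑ x ∈ (Finset.univ.map φ)ᶜ, h x := by
  rw [weight, ← Finset.sum_add_sum_compl (Finset.univ.map φ), Finset.sum_map]
  rfl

end Pendant

section Leaf

variable {V W : Type*} {G : SimpleGraph V} {H : SimpleGraph W} {φ : V ↪ W} {u : V} {z : W}
  {X : Set V} {g : V → ℕ} {h : W → ℕ}

/-- `H` arises from `G` by attaching the new endvertex `z` to `u`. -/
structure LeafExt (G : SimpleGraph V) (H : SimpleGraph W) (φ : V ↪ W) (u : V) (z : W) : Prop
    extends PendantExt G H φ u z where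
  eq_of_notMem : ∀ x, x ∉ Set.range φ → x = z

lemma LeafExt.eq_or_exists (P : LeafExt G H φ u z) (x : W) : x = z ∨ ∃ a, φ a = x :=
  or_iff_not_imp_right.2 (P.eq_of_notMem x)

lemma LeafExt.eq_of_adj (P : LeafExt G H φ u z) {x : W} (h : H.Adj z x) : x = φ u := by
  obtain rfl | ⟨a, rfl⟩ := P.eq_or_exists x
  · exact absurd rfl h.ne
  · rw [((P.adj_new_iff a z P.notMem).1 h.symm).1]

lemma LeafExt.isWRDF_iff (P : LeafExt G H φ u z) (hz : h z = 0) :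
    IsWRDF H (φ '' X) h ↔ IsWRDF G X (h ∘ φ) :=
  ⟨P.isWRDF_comp subset_rfl (.inl hz), P.isWRDF_of_comp coveredOutside_image fun x hx => by
    simp [P.eq_of_notMem x hx, hz]⟩

lemma LeafExt.isRDF_iff (P : LeafExt G H φ u z) (hz : h z = 0) :
    IsRDF H (φ '' X) h ↔ IsRDF G X (h ∘ φ) :=
  ⟨P.isRDF_comp subset_rfl (.inl hz), P.isRDF_of_comp coveredOutside_image fun x hx => by
    simp [P.eq_of_notMem x hx, hz]⟩

lemma PendantExt.extend_zero_apply (P : PendantExt G H φ u z) : Function.extend φ g 0 z = 0 :=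
  Function.extend_apply' _ _ _ P.notMem

open scoped Classical in
/-- The value at the endvertex `z` is moved to its neighbor, capped at `2`. -/
noncomputable def pushLeaf (φ : V ↪ W) (u : V) (z : W) (h : W → ℕ) : V → ℕ :=
  Function.update (h ∘ φ) u (min 2 (h (φ u) + h z))

lemma pushLeaf_self : pushLeaf φ u z h u = min 2 (h (φ u) + h z) := by
  simp [pushLeaf]

lemma pushLeaf_of_ne {a : V} (ha : a ≠ u) : pushLeaf φ u z h a = h (φ a) := by
  simp [pushLeaf, ha]

lemma le_pushLeaf (hle : h (φ u) ≤ 2) (a : V) : h (φ a) ≤ pushLeaf φ u z h a := by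
  rcases eq_or_ne a u with rfl | ha
  · rw [pushLeaf_self]
    omega
  · rw [pushLeaf_of_ne ha]

lemma LeafExt.isWRDF_pushLeaf (P : LeafExt G H φ u z) (hh : IsWRDF H (φ '' X) h) :
    IsWRDF G X (pushLeaf φ u z h) := by
  have hle := le_pushLeaf (z := z) (hh.le_two (φ u))
  have hz : pushLeaf φ u z h u = 0 → h z = 0 := by
    rw [pushLeaf_self]
    omega
  refine ⟨fun a => mem_zero_one_two_iff.2 ?_, fun x hx hx0 => ?_⟩
  · rcases eq_or_ne a u with rfl | ha
    · rw [pushLeaf_self]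
      exact min_le_left _ _
    · rw [pushLeaf_of_ne ha]
      exact hh.le_two _
  obtain ⟨y, hxy, hy, hdom⟩ :=
    isDefended_iff.1 (hh.2 _ ⟨x, hx, rfl⟩ (Nat.eq_zero_of_le_zero (hx0 ▸ hle x)))
  obtain rfl | ⟨b, rfl⟩ := P.eq_or_exists y
  · obtain ⟨rfl, -⟩ := (P.adj_new_iff x y P.notMem).1 hxy
    exact absurd (hz hx0) (by omega)
  refine isDefended_iff.2
    ⟨b, .of_forall_zero ((P.adj_iff _ _).1 hxy) (hy.trans (hle b)) fun q hq hq0 => ?_⟩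
  obtain ⟨t, hqt, ht⟩ := hdom _ ⟨q, hq, rfl⟩
  obtain rfl | ⟨t, rfl⟩ := P.eq_or_exists t
  · have hqu := ((P.adj_new_iff q t P.notMem).1
      (hqt.resolve_left (by rintro rfl; exact P.notMem ⟨q, rfl⟩))).1
    have hpos := (ht.resolve_left (by rintro rfl; exact P.notMem ⟨x, rfl⟩)).1
    exact absurd (hz (hqu ▸ hq0)) (by omega)
  · refine ⟨t, by simpa [P.adj_iff] using hqt, ht.imp (φ.injective ·) fun ht => ?_⟩
    exact ⟨ht.1.trans (hle t), fun htb => (ht.2 (congrArg φ htb)).trans (hle b)⟩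

lemma LeafExt.isPrivate_of_pushLeaf (P : LeafExt G H φ u z) {a : V}
    (ha : IsPrivate G X (pushLeaf φ u z h) u a) : IsPrivate H (φ '' X) h (φ u) (φ a) := by
  obtain ⟨haX, hau, ha0, haN⟩ := ha
  refine ⟨⟨a, haX, rfl⟩, (P.adj_iff _ _).2 hau, by rwa [pushLeaf_of_ne hau.ne] at ha0,
    fun y hay hy => ?_⟩
  obtain rfl | ⟨b, rfl⟩ := P.eq_or_exists y
  · exact absurd ((P.adj_new_iff a y P.notMem).1 hay).1 hau.ne
  · have hbu : b ≠ u := fun h => hy (congrArg φ h)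
    exact (pushLeaf_of_ne hbu).symm.trans (haN b ((P.adj_iff _ _).1 hay) hbu)

lemma LeafExt.apply_eq_zero_of_strong [Fintype W] (P : LeafExt G H φ u z)
    (hS : Strong H (φ '' X)) (hh : IsMinWRDF H (φ '' X) h) : h z = 0 := by
  have hle := hh.1.le_two z
  by_contra h0
  obtain h1 | h2 : h z = 1 ∨ h z = 2 := by omega
  · obtain ⟨⟨a, -, ha⟩, -⟩ := hh.mem_and_forall_ne_two_of_eq_one (hS h hh) h1
    exact P.notMem ⟨a, ha⟩
  · obtain ⟨x, hx, hxu⟩ := hh.exists_isPrivate_ne (hS h hh) h2 (φ u)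
    exact hxu (P.eq_of_adj hx.2.1.symm)

variable [Fintype V] [Fintype W]

lemma LeafExt.weight_eq (P : LeafExt G H φ u z) (h : W → ℕ) :
    weight h = weight (h ∘ φ) + h z := by
  classical
  have hnew : (Finset.univ.map φ)ᶜ = {z} := by
    ext x
    simpa using ⟨fun hx => P.eq_of_notMem x (by simpa using hx),
      by rintro rfl; simpa using P.notMem⟩
  rw [weight_eq_comp_add φ, hnew, Finset.sum_singleton]

lemma LeafExt.weight_extend (P : LeafExt G H φ u z) (g : V → ℕ) :
    weight (Function.extend φ g 0) = weight g := by
  rw [P.weight_eq, Function.extend_comp φ.injective, P.extend_zero_apply, add_zero]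

lemma LeafExt.weight_pushLeaf (P : LeafExt G H φ u z) (h : W → ℕ) :
    weight (pushLeaf φ u z h) + (h (φ u) + h z) = weight h + min 2 (h (φ u) + h z) := by
  classical
  have hw : weight (pushLeaf φ u z h) + h (φ u) = weight (h ∘ φ) + min 2 (h (φ u) + h z) := by
    rw [← weight_update (h ∘ φ) u, pushLeaf]
    congr!
  have hP := P.weight_eq h
  omega

lemma LeafExt.isMinWRDF_extend (P : LeafExt G H φ u z) (hg : IsMinWRDF G X g) :
    IsMinWRDF H (φ '' X) (Function.extend φ g 0) := by
  have hW := hg.1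
  rw [← Function.extend_comp φ.injective g 0, ← P.isWRDF_iff P.extend_zero_apply] at hW
  refine hW.isMinWRDF fun h hh => ?_
  have hle := hg.weight_le (P.isWRDF_pushLeaf hh)
  have hpush := P.weight_pushLeaf h
  have hext := P.weight_extend g
  omega

lemma LeafExt.isMinWRDF_pushLeaf (P : LeafExt G H φ u z) (hh : IsMinWRDF H (φ '' X) h) :
    IsMinWRDF G X (pushLeaf φ u z h) ∧ h (φ u) + h z ≤ 2 := by
  obtain ⟨g, hg⟩ := exists_isMinWRDF G X
  have hle := hh.weight_le (P.isMinWRDF_extend hg).1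
  have hge := hg.weight_le (P.isWRDF_pushLeaf hh.1)
  have hpush := P.weight_pushLeaf h
  have hext := P.weight_extend g
  exact ⟨hg.of_weight_le (P.isWRDF_pushLeaf hh.1) (by omega), by omega⟩

lemma LeafExt.isMinWRDF_comp (P : LeafExt G H φ u z) (hh : IsMinWRDF H (φ '' X) h)
    (hz : h z = 0) : IsMinWRDF G X (h ∘ φ) := by
  obtain ⟨g, hg⟩ := exists_isMinWRDF G X
  have hle := hh.weight_le (P.isMinWRDF_extend hg).1
  have hext := P.weight_extend g
  have hcomp := P.weight_eq h
  exact hg.of_weight_le ((P.isWRDF_iff hz).1 hh.1) (by omega)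

/-- If `h` were positive at `z`, moving its value to `u` would give `u` the value `2`, hence two
private neighbors, and these force `h (φ u) = 2` already. -/
lemma LeafExt.apply_eq_zero (P : LeafExt G H φ u z) (hS : Strong G X)
    (hN : G.IsIndepSet (G.neighborSet u)) (hu : ∀ g, IsMinWRDF G X g → g u ≠ 1)
    (hh : IsMinWRDF H (φ '' X) h) : h z = 0 := by
  by_contra h0
  obtain ⟨hg, hle⟩ := P.isMinWRDF_pushLeaf hh
  have hne := hu _ hg
  have htwo : pushLeaf φ u z h u = 2 := by
    rw [pushLeaf_self] at hne ⊢
    omega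
  obtain ⟨a, ha, -⟩ := hg.exists_isPrivate_ne (hS _ hg) htwo u
  obtain ⟨b, hb, hba⟩ := hg.exists_isPrivate_ne (hS _ hg) htwo a
  have := hh.1.two_le_of_isPrivate (P.isPrivate_of_pushLeaf ha) (P.isPrivate_of_pushLeaf hb)
    (fun h => hba (φ.injective h).symm)
    (fun h => hN hb.2.1.symm ha.2.1.symm hba ((P.adj_iff _ _).1 h))
  omega

lemma LeafExt.strong (P : LeafExt G H φ u z) (hS : Strong G X)
    (hN : G.IsIndepSet (G.neighborSet u)) (hu : ∀ g, IsMinWRDF G X g → g u ≠ 1) :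
    Strong H (φ '' X) := fun _ hh =>
  have hz := P.apply_eq_zero hS hN hu hh
  (P.isRDF_iff hz).2 (hS _ (P.isMinWRDF_comp hh hz))

lemma LeafExt.strong_of_strong (P : LeafExt G H φ u z) (hS : Strong H (φ '' X)) :
    Strong G X := fun g hg => by
  have hR := hS _ (P.isMinWRDF_extend hg)
  rwa [P.isRDF_iff P.extend_zero_apply, Function.extend_comp φ.injective] at hR

lemma LeafExt.apply_ne_one (P : LeafExt G H φ u z) (hS : Strong H (φ '' X))
    (hg : IsMinWRDF G X g) : g u ≠ 1 := fun hu =>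
  hS.apply_ne_zero_of_adj (P.isMinWRDF_extend hg) P.adj
    (by rw [φ.injective.extend_apply, hu]) P.extend_zero_apply

lemma LeafExt.apply_mem_coverable_iff (P : LeafExt G H φ u z) (hS : Strong H (φ '' X)) (a : V) :
    φ a ∈ coverable H (φ '' X) ↔ a ∈ coverable G X := by
  have hiff : ∀ h : W → ℕ, h z = 0 →
      (IsDefended H (φ '' X) h (φ a) ↔ IsDefended G X (h ∘ φ) a) := fun h hz =>
    P.isDefended_apply_iff subset_rfl coveredOutside_image (.inl hz)
  constructor
  · rintro ⟨h, hh, hc⟩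
    have hz := P.apply_eq_zero_of_strong hS hh
    rw [hiff h hz] at hc
    exact ⟨h ∘ φ, P.isMinWRDF_comp hh hz, hc⟩
  · rintro ⟨g, hg, hc⟩
    refine ⟨_, P.isMinWRDF_extend hg, ?_⟩
    rwa [hiff _ P.extend_zero_apply, Function.extend_comp φ.injective, φ.injective.extend_apply]

lemma LeafExt.new_mem_coverable_iff (P : LeafExt G H φ u z) (hS : Strong H (φ '' X)) :
    z ∈ coverable H (φ '' X) ↔ ∃ g, IsMinWRDF G X g ∧ g u = 2 := by
  constructor
  · rintro ⟨h, hh, hc⟩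
    have hz := P.apply_eq_zero_of_strong hS hh
    have hg := P.isMinWRDF_comp hh hz
    obtain ⟨y, hzy, hy, -⟩ := (hc.resolve_left (by omega)).2
    obtain rfl := P.eq_of_adj hzy
    have hne : h (φ u) ≠ 1 := P.apply_ne_one hS hg
    have hle := hh.1.le_two (φ u)
    exact ⟨h ∘ φ, hg, show h (φ u) = 2 by omega⟩
  · rintro ⟨g, hg, hu⟩
    exact mem_coverable_of_adj_two (P.isMinWRDF_extend hg) P.adj.symm
      (by rwa [φ.injective.extend_apply])

lemma LeafExt.coverable_eq_of_never_two (P : LeafExt G H φ u z) (hS : Strong H (φ '' X))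
    (hu : ∀ g, IsMinWRDF G X g → g u ≠ 2) : coverable H (φ '' X) = φ '' coverable G X := by
  ext x
  obtain rfl | ⟨a, rfl⟩ := P.eq_or_exists x
  · rw [P.new_mem_coverable_iff hS]
    exact iff_of_false (fun ⟨g, hg, h⟩ => hu g hg h) fun ⟨a, _, ha⟩ => P.notMem ⟨a, ha⟩
  · rw [P.apply_mem_coverable_iff hS, φ.injective.mem_set_image]

lemma LeafExt.coverable_eq_of_two (P : LeafExt G H φ u z) (hS : Strong H (φ '' X))
    (hu : ∃ g, IsMinWRDF G X g ∧ g u = 2) : coverable H (φ '' X) = φ '' coverable G X ∪ {z} := by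
  ext x
  obtain rfl | ⟨a, rfl⟩ := P.eq_or_exists x
  · rw [P.new_mem_coverable_iff hS]
    exact iff_of_true hu (Or.inr rfl)
  · rw [P.apply_mem_coverable_iff hS, Set.mem_union, φ.injective.mem_set_image,
      Set.mem_singleton_iff, or_iff_left fun h => P.notMem ⟨a, h⟩]

end Leaf

section AddDemand

variable {V : Type*} {G : SimpleGraph V} {X : Set V} {g : V → ℕ} {p u v : V}

lemma Defends.mono {X' : Set V} (hX : X ⊆ X') (hd : Defends G X' g u v) : Defends G X g u v :=
  ⟨hd.1, hd.2.1, fun q hq => hd.2.2 q (hX hq)⟩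

lemma IsWRDF.mono {X' : Set V} (hX : X ⊆ X') (hg : IsWRDF G X' g) : IsWRDF G X g :=
  ⟨hg.1, fun x hx hx0 =>
    let ⟨y, hy⟩ := isDefended_iff.1 (hg.2 x (hX hx) hx0)
    isDefended_iff.2 ⟨y, hy.mono hX⟩⟩

lemma isDefended_insert_iff (hpv : G.Adj p v) (hv : g v = 2) :
    IsDefended G (insert p X) g u ↔ IsDefended G X g u := by
  rw [isDefended_iff, isDefended_iff]
  refine exists_congr fun y => ⟨.mono (Set.subset_insert p X), fun h => ⟨h.1, h.2.1, ?_⟩⟩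
  rintro q (rfl | hq)
  · exact ⟨v, Or.inr hpv, Or.inr ⟨by omega, by rintro rfl; exact hv.ge⟩⟩
  · exact h.2.2 q hq

lemma IsWRDF.insert (hg : IsWRDF G X g) (hpv : G.Adj p v) (hv : g v = 2) :
    IsWRDF G (insert p X) g := by
  refine ⟨hg.1, fun x hx hx0 => (isDefended_insert_iff hpv hv).2 ?_⟩
  obtain rfl | hx := hx
  · exact isDefended_of_adj_two hpv hv fun _ => hg.exists_adj_pos
  · exact hg.2 x hx hx0

variable [Fintype V]

lemma isMinWRDF_insert_iff (hpv : G.Adj p v) (hv : ∀ g, IsMinWRDF G X g → g v = 2) :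
    IsMinWRDF G (insert p X) g ↔ IsMinWRDF G X g := by
  have hmono : ∀ {k}, IsWRDF G (insert p X) k → IsWRDF G X k := .mono (Set.subset_insert p X)
  constructor
  · intro hg
    obtain ⟨k, hk⟩ := exists_isMinWRDF G X
    exact hk.of_weight_le (hmono hg.1) (hg.weight_le (hk.1.insert hpv (hv k hk)))
  · intro hg
    exact (hg.1.insert hpv (hv g hg)).isMinWRDF fun k hk => hg.weight_le (hmono hk)

lemma Strong.insert (hS : Strong G X) (hpv : G.Adj p v) (hv : ∀ g, IsMinWRDF G X g → g v = 2) :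
    Strong G (insert p X) := by
  intro g hg
  rw [isMinWRDF_insert_iff hpv hv] at hg
  refine ⟨hg.1.1, ?_⟩
  rintro x (rfl | hx) hx0
  · exact ⟨v, hpv, hv g hg⟩
  · exact (hS g hg).2 x hx hx0

lemma coverable_insert (hpv : G.Adj p v) (hv : ∀ g, IsMinWRDF G X g → g v = 2) :
    coverable G (insert p X) = coverable G X := by
  ext x
  refine exists_congr fun g => ?_
  rw [isMinWRDF_insert_iff hpv hv]
  exact and_congr_right fun hg => by rw [isDefended_insert_iff hpv (hv g hg)]

end AddDemand

section Star

variable {V W : Type*} {G : SimpleGraph V} {H : SimpleGraph W} {φ : V ↪ W} {u : V} {v : W}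
  {X : Set V} {X' : Set W} {g : V → ℕ} {h : W → ℕ}

/-- `H` arises from `G` by attaching the center `v` of a star to `u`. -/
structure StarExt (G : SimpleGraph V) (H : SimpleGraph W) (φ : V ↪ W) (u : V) (v : W) : Prop
    extends PendantExt G H φ u v where
  adj_center : ∀ x, x ∉ Set.range φ → x ≠ v → H.Adj x v
  not_adj : ∀ x y, x ∉ Set.range φ → x ≠ v → y ∉ Set.range φ → y ≠ v → ¬ H.Adj x y

/-- The endvertices of the attached star that belong to `X'`. -/
def demandingLeaves (φ : V ↪ W) (v : W) (X' : Set W) : Set W := X' \ insert v (Set.range φ)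

/-- The sets of demands of `G` and `H` agree away from `u` and the attached star. -/
structure DemandExt (φ : V ↪ W) (u : V) (X : Set V) (X' : Set W) : Prop where
  image_subset : φ '' X ⊆ X'
  subset : X' ⊆ φ '' X ∪ {φ u} ∪ (Set.range φ)ᶜ
  notMem : u ∉ X

lemma demandingLeaves_eq_inter {L : Set W}
    (hL : (Set.range φ)ᶜ = insert v L) (hv : v ∉ L) : demandingLeaves φ v X' = X' ∩ L := by
  ext x
  have hx : x ∉ Set.range φ ↔ x = v ∨ x ∈ L := Set.ext_iff.1 hL x
  rw [demandingLeaves, Set.mem_sdiff, Set.mem_insert_iff, Set.mem_inter_iff]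
  grind

lemma demandExt_union {S : Set W} (hu : u ∉ X)
    (hS : S ⊆ insert (φ u) (Set.range φ)ᶜ) : DemandExt φ u X (φ '' X ∪ S) where
  image_subset := Set.subset_union_left
  subset := by
    rw [Set.union_assoc]
    exact Set.union_subset_union_right _ hS
  notMem := hu

lemma DemandExt.eq_union (D : DemandExt φ u X X') :
    X' = φ '' X ∪ (X' ∩ insert (φ u) (Set.range φ)ᶜ) := by
  have := D.image_subset
  have := D.subset
  grind

lemma DemandExt.sdiff_singleton (D : DemandExt φ u X X') {z : W} (hz : z ∉ Set.range φ) :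
    DemandExt φ u X (X' \ {z}) :=
  ⟨Set.subset_sdiff_singleton D.image_subset fun h => hz (Set.image_subset_range _ _ h),
    Set.sdiff_subset.trans D.subset, D.notMem⟩

lemma StarExt.eq_of_adj (P : StarExt G H φ u v) {x y : W} (hx : x ∉ insert v (Set.range φ))
    (h : H.Adj x y) : y = v := by
  obtain ⟨hxv, hx⟩ := not_or.1 hx
  by_contra hy
  by_cases hyr : y ∈ Set.range φ
  · obtain ⟨b, rfl⟩ := hyr
    exact hxv ((P.adj_new_iff b x hx).1 h.symm).2
  · exact P.not_adj x y hx hxv hyr hy h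

lemma StarExt.isPrivate (P : StarExt G H φ u v) {w : W} (hw : w ∈ demandingLeaves φ v X')
    (h0 : h w = 0) : IsPrivate H X' h v w :=
  ⟨hw.1, P.adj_center w (fun h => hw.2 (Or.inr h)) (fun h => hw.2 (Or.inl h)), h0,
    fun _ hy hyv => absurd (P.eq_of_adj hw.2 hy) hyv⟩

lemma StarExt.one_le_center (P : StarExt G H φ u v) (hh : IsWRDF H X' h) {w : W}
    (hw : w ∈ demandingLeaves φ v X') (h0 : h w = 0) : 1 ≤ h v :=
  (hh.defends_of_isPrivate (P.isPrivate hw h0)).2.1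

lemma StarExt.two_le_center (P : StarExt G H φ u v) (hh : IsWRDF H X' h) {w w' : W}
    (hw : w ∈ demandingLeaves φ v X') (hw' : w' ∈ demandingLeaves φ v X') (hne : w ≠ w')
    (h0 : h w = 0) (h0' : h w' = 0) : 2 ≤ h v :=
  hh.two_le_of_isPrivate (P.isPrivate hw h0) (P.isPrivate hw' h0') hne fun hadj =>
    hw.2 (Or.inl (P.eq_of_adj hw'.2 hadj))

lemma StarExt.coveredOutside (P : StarExt G H φ u v) (D : DemandExt φ u X X') (hv : h v = 2) :
    CoveredOutside H φ X X' h := fun p hp hpX => by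
  refine ⟨v, P.notMem, ?_, hv⟩
  rcases D.subset hp with (hpX' | rfl) | hpr
  · exact absurd hpX' hpX
  · exact Or.inr P.adj
  · by_cases hpv : p = v
    · exact Or.inl hpv.symm
    · exact Or.inr (P.adj_center p hpr hpv)

open scoped Classical in
/-- Extension of a function by the value `2` at the center of the attached star and `0` at its
endvertices. -/
noncomputable def extendStar (φ : V ↪ W) (v : W) (g : V → ℕ) : W → ℕ :=
  Function.extend φ g (Pi.single v 2)

lemma StarExt.extendStar_center (P : StarExt G H φ u v) (g : V → ℕ) :
    extendStar φ v g v = 2 := by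
  classical
  rw [extendStar, Function.extend_apply' _ _ _ P.notMem, Pi.single_eq_same]

lemma extendStar_leaf (g : V → ℕ) {x : W} (hx : x ∉ insert v (Set.range φ)) :
    extendStar φ v g x = 0 := by
  classical
  obtain ⟨hxv, hx⟩ := not_or.1 hx
  rw [extendStar, Function.extend_apply' _ _ _ hx, Pi.single_eq_of_ne hxv]

lemma extendStar_apply (g : V → ℕ) (a : V) : extendStar φ v g (φ a) = g a :=
  φ.injective.extend_apply _ _ _

lemma extendStar_comp (g : V → ℕ) : extendStar φ v g ∘ φ = g :=
  Function.extend_comp φ.injective _ _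

lemma StarExt.extendStar_le_two (P : StarExt G H φ u v) (g : V → ℕ) :
    ∀ x ∉ Set.range φ, extendStar φ v g x ≤ 2 := fun x hx => by
  rcases eq_or_ne x v with rfl | hxv
  · exact (P.extendStar_center g).le
  · exact (extendStar_leaf g (not_or.2 ⟨hxv, hx⟩)).trans_le zero_le_two

lemma StarExt.isWRDF_extendStar (P : StarExt G H φ u v) (D : DemandExt φ u X X')
    (hg : IsWRDF G X g) : IsWRDF H X' (extendStar φ v g) :=
  P.isWRDF_of_comp (P.coveredOutside D (P.extendStar_center g)) (P.extendStar_le_two g)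
    (by rwa [extendStar_comp])

variable [Fintype V] [Fintype W]

lemma StarExt.weight_extendStar (P : StarExt G H φ u v) (g : V → ℕ) :
    weight (extendStar φ v g) = weight g + 2 := by
  classical
  rw [weight_eq_comp_add φ, extendStar_comp, Finset.sum_eq_single_of_mem v]
  · rw [P.extendStar_center]
  · simpa using P.notMem
  · intro b hb hbv
    exact extendStar_leaf g (not_or.2 ⟨hbv, by simpa using hb⟩)

lemma StarExt.weight_comp_add_le (P : StarExt G H φ u v) (h : W → ℕ) {s : Finset W}
    (hs : ∀ x ∈ s, x ∉ insert v (Set.range φ)) :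
    weight (h ∘ φ) + (h v + ∑ x ∈ s, h x) ≤ weight h := by
  classical
  rw [weight_eq_comp_add φ h, ← Finset.sum_insert fun hv => hs v hv (Set.mem_insert _ _)]
  gcongr
  refine Finset.insert_subset (by simpa using P.notMem) fun x hx => ?_
  simpa using (not_or.1 (hs x hx)).2

lemma StarExt.weight_comp_add_pair_le (P : StarExt G H φ u v) (h : W → ℕ) {w w' : W}
    (hw : w ∈ demandingLeaves φ v X') (hw' : w' ∈ demandingLeaves φ v X') (hne : w ≠ w') :
    weight (h ∘ φ) + (h v + (h w + h w')) ≤ weight h := by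
  classical
  have hle := P.weight_comp_add_le h (s := {w, w'}) fun x hx => by
    simp only [Finset.mem_insert, Finset.mem_singleton] at hx
    obtain rfl | rfl := hx
    exacts [hw.2, hw'.2]
  rwa [Finset.sum_pair hne] at hle

lemma StarExt.weight_comp_add_two_le (P : StarExt G H φ u v)
    (hN : (demandingLeaves φ v X').Nontrivial) (hh : IsWRDF H X' h) :
    weight (h ∘ φ) + 2 ≤ weight h := by
  obtain ⟨w, hw, w', hw', hne⟩ := hN
  have hle := P.weight_comp_add_pair_le h hw hw' hne
  have hw1 := P.one_le_center hh hw
  have hw1' := P.one_le_center hh hw'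
  have hww' := P.two_le_center hh hw hw' hne
  omega

lemma StarExt.isMinWRDF_extendStar (P : StarExt G H φ u v) (D : DemandExt φ u X X')
    (hN : (demandingLeaves φ v X').Nontrivial) (hg : IsMinWRDF G X g) :
    IsMinWRDF H X' (extendStar φ v g) := by
  refine (P.isWRDF_extendStar D hg.1).isMinWRDF fun h hh => ?_
  rw [P.weight_extendStar]
  exact (Nat.add_le_add_right
    (hg.weight_le (P.isWRDF_comp D.image_subset (.inr D.notMem) hh)) 2).trans
    (P.weight_comp_add_two_le hN hh)

lemma StarExt.isMinWRDF_comp (P : StarExt G H φ u v) (D : DemandExt φ u X X')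
    (hN : (demandingLeaves φ v X').Nontrivial) (hh : IsMinWRDF H X' h) :
    IsMinWRDF G X (h ∘ φ) ∧ weight h = weight (h ∘ φ) + 2 := by
  obtain ⟨g, hg⟩ := exists_isMinWRDF G X
  have hW : IsWRDF G X (h ∘ φ) := P.isWRDF_comp D.image_subset (.inr D.notMem) hh.1
  have hlow := P.weight_comp_add_two_le hN hh.1
  have hup := hh.weight_le (P.isWRDF_extendStar D hg.1)
  have hext := P.weight_extendStar g
  have hle := hg.weight_le hW
  exact ⟨hg.of_weight_le hW (by omega), by omega⟩

lemma StarExt.strong (P : StarExt G H φ u v) (D : DemandExt φ u X X')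
    (hN : (demandingLeaves φ v X').Nontrivial) (hv : ∀ h, IsMinWRDF H X' h → h v = 2)
    (hS : Strong G X) : Strong H X' := fun h hh =>
  P.isRDF_of_comp (P.coveredOutside D (hv h hh)) (fun x _ => hh.1.le_two x)
    (hS _ (P.isMinWRDF_comp D hN hh).1)

lemma StarExt.strong_of_strong (P : StarExt G H φ u v) (D : DemandExt φ u X X')
    (hN : (demandingLeaves φ v X').Nontrivial) (hS : Strong H X') : Strong G X := fun g hg => by
  rw [← extendStar_comp (φ := φ) (v := v) g]
  exact P.isRDF_comp D.image_subset (.inr D.notMem) (hS _ (P.isMinWRDF_extendStar D hN hg))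

omit [Fintype V] in
lemma StarExt.mem_coverable_of_eq_or_adj (P : StarExt G H φ u v) (D : DemandExt φ u X X')
    (hN : (demandingLeaves φ v X').Nontrivial) {x : W} (hx : x = v ∨ H.Adj x v) :
    x ∈ coverable H X' := by
  let : Fintype V := .ofInjective φ φ.injective
  obtain ⟨g, hg⟩ := exists_isMinWRDF G X
  have hmin := P.isMinWRDF_extendStar D hN hg
  have hv := P.extendStar_center g
  obtain rfl | hx := hx
  · exact ⟨_, hmin, Or.inl (by omega)⟩
  · exact mem_coverable_of_adj_two hmin hx hv

lemma StarExt.apply_mem_coverable_iff (P : StarExt G H φ u v) (D : DemandExt φ u X X')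
    (hN : (demandingLeaves φ v X').Nontrivial) (hv : ∀ h, IsMinWRDF H X' h → h v = 2) {a : V}
    (ha : a ≠ u) : φ a ∈ coverable H X' ↔ a ∈ coverable G X := by
  have hiff : ∀ h : W → ℕ, h v = 2 →
      (IsDefended H X' h (φ a) ↔ IsDefended G X (h ∘ φ) a) := fun h hv =>
    P.isDefended_apply_iff D.image_subset (P.coveredOutside D hv) (.inr ⟨D.notMem, ha⟩)
  constructor
  · rintro ⟨h, hh, hc⟩
    rw [hiff h (hv h hh)] at hc
    exact ⟨h ∘ φ, (P.isMinWRDF_comp D hN hh).1, hc⟩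
  · rintro ⟨g, hg, hc⟩
    refine ⟨_, P.isMinWRDF_extendStar D hN hg, ?_⟩
    rwa [hiff _ (P.extendStar_center g), extendStar_comp, extendStar_apply]

lemma StarExt.coverable_eq (P : StarExt G H φ u v) (D : DemandExt φ u X X')
    (hN : (demandingLeaves φ v X').Nontrivial) (hv : ∀ h, IsMinWRDF H X' h → h v = 2) :
    coverable H X' = φ '' coverable G X ∪ {φ u} ∪ (Set.range φ)ᶜ := by
  have hcov : ∀ {x}, x = v ∨ H.Adj x v → x ∈ coverable H X' := P.mem_coverable_of_eq_or_adj D hN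
  ext x
  by_cases hx : x ∈ Set.range φ
  · obtain ⟨a, rfl⟩ := hx
    rcases eq_or_ne a u with rfl | hau
    · exact iff_of_true (hcov (Or.inr P.adj)) (Or.inl (Or.inr rfl))
    · rw [P.apply_mem_coverable_iff D hN hv hau]
      simp [hau]
  · exact iff_of_true (hcov (or_iff_not_imp_left.2 (P.adj_center x hx))) (Or.inr hx)

omit [Fintype V] in
lemma StarExt.center_eq_two_of_three (P : StarExt G H φ u v) (D : DemandExt φ u X X')
    (hN : 2 < (demandingLeaves φ v X').ncard) (hh : IsMinWRDF H X' h) : h v = 2 := by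
  classical
  let : Fintype V := .ofInjective φ φ.injective
  obtain ⟨w₁, w₂, w₃, h₁, h₂, h₃, h12, h13, h23⟩ := (Set.two_lt_ncard_iff).1 hN
  have hcomp := (P.isMinWRDF_comp D ⟨w₁, h₁, w₂, h₂, h12⟩ hh).2
  have hle := P.weight_comp_add_le h (s := {w₁, w₂, w₃}) fun x hx => by
    simp only [Finset.mem_insert, Finset.mem_singleton] at hx
    obtain rfl | rfl | rfl := hx
    exacts [h₁.2, h₂.2, h₃.2]
  rw [Finset.sum_insert (by simp [h12, h13]), Finset.sum_pair h23] at hle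
  have hone := P.one_le_center hh.1 h₁
  have hzero12 := P.two_le_center hh.1 h₁ h₂ h12
  have hzero13 := P.two_le_center hh.1 h₁ h₃ h13
  have hzero23 := P.two_le_center hh.1 h₂ h₃ h23
  have hone₂ := P.one_le_center hh.1 h₂
  have hone₃ := P.one_le_center hh.1 h₃
  have hv := hh.1.le_two v
  omega

omit [Fintype V] in
lemma StarExt.strong_sdiff_singleton (P : StarExt G H φ u v) (D : DemandExt φ u X X') {z : W}
    (hz : z ∉ Set.range φ) (hN : 2 < (demandingLeaves φ v (X' \ {z})).ncard) (hS : Strong H X') :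
    Strong H (X' \ {z}) := by
  let : Fintype V := .ofInjective φ φ.injective
  have hmono : demandingLeaves φ v (X' \ {z}) ⊆ demandingLeaves φ v X' :=
    Set.sdiff_subset_sdiff_left Set.sdiff_subset
  have hN' : (demandingLeaves φ v (X' \ {z})).Nontrivial :=
    Set.one_lt_ncard_iff_nontrivial.1 (by omega)
  exact P.strong (D.sdiff_singleton hz) hN'
    (fun h hh => P.center_eq_two_of_three (D.sdiff_singleton hz) hN hh)
    (P.strong_of_strong D (hN'.mono hmono) hS)

/-- A vertex `u` that cannot be covered within `G` has to be defended by the center. -/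
lemma StarExt.center_eq_two_of_two (P : StarExt G H φ u v) (D : DemandExt φ u X X')
    (hN : (demandingLeaves φ v X').Nontrivial) (hu : φ u ∈ X') (huY : u ∉ coverable G X)
    (hh : IsMinWRDF H X' h) : h v = 2 := by
  obtain ⟨hg, hcomp⟩ := P.isMinWRDF_comp D hN hh
  have hu0 : (h ∘ φ) u = 0 := apply_eq_zero_of_notMem_coverable hg huY
  obtain ⟨y, hy⟩ := isDefended_iff.1 (hh.1.2 _ hu hu0)
  obtain rfl : y = v := by
    by_cases hyr : y ∈ Set.range φ
    · obtain ⟨b, rfl⟩ := hyr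
      exact absurd ⟨h ∘ φ, hg, Or.inr ⟨hu0, isDefended_iff.2
        ⟨b, P.defends_comp D.image_subset (.inr D.notMem) hy⟩⟩⟩ huY
    · exact ((P.adj_new_iff u y hyr).1 hy.1).2
  have htwo : ∀ w ∈ demandingLeaves φ y X', h w = 0 → 2 ≤ h y := fun w hw h0 => by
    have hne : φ u ≠ y := hy.1.ne
    exact hy.two_le_of_isPrivate (P.isPrivate hw h0)
      (by rintro rfl; exact hw.2 (Or.inr ⟨u, rfl⟩)) fun hadj => hne (P.eq_of_adj hw.2 hadj)
  obtain ⟨w, hw, w', hw', hne⟩ := hN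
  have hle := P.weight_comp_add_pair_le h hw hw' hne
  have hw2 := htwo w hw
  have hw2' := htwo w' hw'
  have hpos := hy.2.1
  have hv := hh.1.le_two y
  omega

/-- The center needs a third private neighbor besides its two demanding leaves, and this can only
be `φ u`. -/
lemma StarExt.isPrivate_extendStar (P : StarExt G H φ u v) (D : DemandExt φ u X X')
    (hN : (demandingLeaves φ v X').ncard = 2) (hS : Strong H X') (hg : IsMinWRDF G X g) :
    IsPrivate H X' (extendStar φ v g) v (φ u) := by
  obtain ⟨w, w', hne, hww'⟩ := Set.ncard_eq_two.1 hN
  obtain ⟨x, hx, hxw, hxw'⟩ := hS.exists_isPrivate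
    (P.isMinWRDF_extendStar D (hww' ▸ Set.nontrivial_pair hne) hg) (P.extendStar_center g) w w'
  by_cases hxr : x ∈ Set.range φ
  · obtain ⟨a, rfl⟩ := hxr
    obtain ⟨rfl, -⟩ := (P.adj_new_iff a v P.notMem).1 hx.2.1
    exact hx
  · have hmem : x ∈ demandingLeaves φ v X' := ⟨hx.1, not_or.2 ⟨hx.2.1.ne, hxr⟩⟩
    rw [hww'] at hmem
    exact absurd hmem (not_or.2 ⟨hxw, hxw'⟩)

lemma StarExt.mem_and_notMem_coverable (P : StarExt G H φ u v) (D : DemandExt φ u X X')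
    (hN : (demandingLeaves φ v X').ncard = 2) (hS : Strong H X') :
    φ u ∈ X' ∧ u ∉ coverable G X := by
  have hpriv : ∀ {g}, IsMinWRDF G X g → IsPrivate H X' (extendStar φ v g) v (φ u) :=
    P.isPrivate_extendStar D hN hS
  obtain ⟨g, hg⟩ := exists_isMinWRDF G X
  refine ⟨(hpriv hg).1, ?_⟩
  rintro ⟨g, hg, hc⟩
  obtain ⟨-, -, h0, hzero⟩ := hpriv hg
  rw [extendStar_apply] at h0
  obtain ⟨b, hb, hb1, -⟩ := (hc.resolve_left (by omega)).2
  have hb0 := hzero (φ b) ((P.adj_iff _ _).2 hb) (by rintro rfl; exact P.notMem ⟨b, rfl⟩)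
  rw [extendStar_apply] at hb0
  omega

end Star

section Branch

variable {V : Type*} {T : SimpleGraph V} {u v w x y : V}

lemma mem_branch_self (h : w ≠ v) : w ∈ branch T v w :=
  ⟨h, h, SimpleGraph.Reachable.refl _⟩

lemma ne_of_mem_branch (h : x ∈ branch T v w) : x ≠ v := h.2.1

lemma mem_branch_of_adj (h : x ∈ branch T v w) (hxy : T.Adj x y) (hy : y ≠ v) :
    y ∈ branch T v w := by
  obtain ⟨hw, hx, hr⟩ := h
  have hadj : (T.induce ({v}ᶜ : Set V)).Adj ⟨x, hx⟩ ⟨y, hy⟩ := hxy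
  exact ⟨hw, hy, hr.trans hadj.reachable⟩

lemma branch_subset {C : Set V} (hw : w ∈ C)
    (hC : ∀ x ∈ C, ∀ y, T.Adj x y → y ≠ v → y ∈ C) : branch T v w ⊆ C := by
  rintro x ⟨hw', hx, ⟨p⟩⟩
  have hwalk : ∀ {a b : ({v}ᶜ : Set V)}, (T.induce ({v}ᶜ : Set V)).Walk a b → (a : V) ∈ C →
      (b : V) ∈ C := by
    intro a b p
    induction p with
    | nil => exact id
    | @cons a c _ h _ ih => exact fun ha => ih (hC a ha c h c.2)
  exact hwalk p hw

lemma eq_of_mem_branch_of_adj (hT : T.IsAcyclic) (hvw : T.Adj v w) (hx : x ∈ branch T v w)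
    (hvx : T.Adj v x) : x = w := by
  by_contra hne
  have hbridge := (SimpleGraph.isAcyclic_iff_forall_adj_isBridge.1 hT) hvw
  rw [SimpleGraph.isBridge_iff] at hbridge
  have hvx' : (T.deleteEdges {s(v, w)}).Adj v x := by
    rw [SimpleGraph.deleteEdges_adj]
    exact ⟨hvx, by simp [hne, hvx.ne.symm]⟩
  have hreach : branch T v w ⊆ {y | (T.deleteEdges {s(v, w)}).Reachable y w} ∩ {v}ᶜ := by
    refine branch_subset ⟨SimpleGraph.Reachable.refl _, hvw.ne'⟩ ?_
    rintro a ⟨ha, hav : a ≠ v⟩ b hab hbv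
    refine ⟨SimpleGraph.Reachable.trans (SimpleGraph.Adj.reachable ?_) ha, hbv⟩
    rw [SimpleGraph.deleteEdges_adj]
    exact ⟨hab.symm, by simp [hbv, hav]⟩
  exact hbridge (hvx'.reachable.trans (hreach hx).1)

lemma isIndepSet_neighborSet (hT : T.IsAcyclic) (v : V) : T.IsIndepSet (T.neighborSet v) :=
  fun _ ha _ hb _ hab => hab.ne' <| eq_of_mem_branch_of_adj hT ha
    (mem_branch_of_adj (mem_branch_self ha.ne') hab hb.ne') hb

lemma eq_of_common_neighbors (hT : T.IsAcyclic) {a b p : V} (hva : T.Adj v a) (hvb : T.Adj v b)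
    (hpa : T.Adj a p) (hpb : T.Adj b p) (hpv : p ≠ v) : a = b :=
  (eq_of_mem_branch_of_adj hT hva (mem_branch_of_adj
    (mem_branch_of_adj (mem_branch_self hva.ne') hpa hpv) hpb.symm hvb.ne') hvb).symm

lemma eq_or_exists_mem_branch (hx : x ∈ branch T u v) :
    x = v ∨ ∃ w, T.Adj v w ∧ w ≠ u ∧ x ∈ branch T v w := by
  suffices h : branch T u v ⊆ {x | x = v ∨ ∃ w, T.Adj v w ∧ w ≠ u ∧ x ∈ branch T v w} from h hx
  refine branch_subset (Or.inl rfl) ?_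
  rintro a (rfl | ⟨w, hw, hwu, ha⟩) b hab hbu
  · exact Or.inr ⟨b, hab, hbu, mem_branch_self hab.ne'⟩
  · by_cases hbv : b = v
    · exact Or.inl hbv
    · exact Or.inr ⟨w, hw, hwu, mem_branch_of_adj ha hab hbv⟩

lemma branch_subset_branch (hT : T.IsAcyclic) (huv : T.Adj u v) (hvw : T.Adj v w) (hwu : w ≠ u) :
    branch T v w ⊆ branch T u v := by
  have hu : u ∉ branch T v w := fun h => hwu (eq_of_mem_branch_of_adj hT hvw h huv.symm).symm
  suffices h : branch T v w ⊆ branch T v w ∩ branch T u v from h.trans Set.inter_subset_right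
  refine branch_subset ⟨mem_branch_self hvw.ne',
    mem_branch_of_adj (mem_branch_self huv.ne') hvw hwu⟩ ?_
  rintro a ⟨ha, ha'⟩ b hab hbv
  have hb := mem_branch_of_adj ha hab hbv
  exact ⟨hb, mem_branch_of_adj ha' hab (by rintro rfl; exact hu hb)⟩

lemma branch_ssubset_branch (hT : T.IsAcyclic) (huv : T.Adj u v) (hvw : T.Adj v w) (hwu : w ≠ u) :
    branch T v w ⊂ branch T u v :=
  ⟨branch_subset_branch hT huv hvw hwu, fun h =>
    ne_of_mem_branch (h (mem_branch_self huv.ne')) rfl⟩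

lemma eq_of_adj_of_notMem_branch (hT : T.IsAcyclic) (huv : T.Adj u v) (hx : x ∈ branch T u v)
    (hy : y ∉ branch T u v) (hxy : T.Adj x y) : x = v ∧ y = u := by
  obtain rfl : y = u := by
    by_contra h
    exact hy (mem_branch_of_adj hx hxy h)
  exact ⟨eq_of_mem_branch_of_adj hT huv hx hxy.symm, rfl⟩

lemma mem_branch_of_adj_of_ne (hT : T.IsAcyclic) (huv : T.Adj u v) (hx : x ∈ branch T u v)
    (hxv : x ≠ v) (hxy : T.Adj x y) : y ∈ branch T u v := by
  by_contra hy
  exact hxv (eq_of_adj_of_notMem_branch hT huv hx hy hxy).1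

end Branch

section Hub

variable {V : Type*} {T : SimpleGraph V} {X : Set V} {u v : V} {g : V → ℕ}

/-- The neighbors of `v` in `X`, other than `u`. -/
def demands (T : SimpleGraph V) (X : Set V) (u v : V) : Set V := (T.neighborSet v ∩ X) \ {u}

/-- In the component of `T - u` that contains the neighbor `v` of `u`, all vertices of `X` belong
to the closed neighborhood of `v`, and some neighbor of `v` there belongs to `X`. In a strong
forest this characterizes the vertices around which there is a configuration. -/
structure IsHub (T : SimpleGraph V) (X : Set V) (u v : V) : Prop where
  acyclic : T.IsAcyclic
  adj : T.Adj u v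
  near : ∀ x ∈ branch T u v, x ∈ X → x = v ∨ T.Adj v x
  demands_nonempty : (demands T X u v).Nonempty

lemma IsHub.mem_self (hH : IsHub T X u v) : v ∈ branch T u v := mem_branch_self hH.adj.ne'

lemma IsHub.mem_of_adj (hH : IsHub T X u v) {w : V} (hw : T.Adj v w) (hwu : w ≠ u) :
    w ∈ branch T u v := mem_branch_of_adj hH.mem_self hw hwu

lemma IsHub.demands_subset (hH : IsHub T X u v) : demands T X u v ⊆ branch T u v :=
  fun _ hw => hH.mem_of_adj hw.1.1 hw.2

lemma IsHub.pos_or_exists_two (hH : IsHub T X u v) (hR : IsRDF T X g) {w : V}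
    (hw : w ∈ demands T X u v) : 1 ≤ g w ∨ ∃ p ∈ branch T u v, T.Adj w p ∧ g p = 2 := by
  rcases Nat.eq_zero_or_pos (g w) with hw0 | hw1
  · obtain ⟨p, hwp, hp⟩ := hR.2 w hw.1.2 hw0
    have hpS := mem_branch_of_adj_of_ne hH.acyclic hH.adj (hH.demands_subset hw) hw.1.1.ne' hwp
    exact Or.inr ⟨p, hpS, hwp, hp⟩
  · exact Or.inl hw1

open scoped Classical in
/-- All weight on the branch at the hub `v` is replaced by the value `2` at `v`. -/
noncomputable def collapse (T : SimpleGraph V) (u v : V) (g : V → ℕ) : V → ℕ :=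
  fun x => if x = v then 2 else if x ∈ branch T u v then 0 else g x

lemma collapse_self : collapse T u v g v = 2 := if_pos rfl

lemma IsHub.isRDF_collapse (hH : IsHub T X u v) (hR : IsRDF T X g) :
    IsRDF T X (collapse T u v g) := by
  refine ⟨fun x => ?_, fun x hx hx0 => ?_⟩
  · unfold collapse
    split_ifs
    · simp
    · simp
    · exact hR.1 x
  by_cases hxS : x ∈ branch T u v
  · rcases hH.near x hxS hx with rfl | h
    · exact absurd hx0 (by simp [collapse])
    · exact ⟨v, h.symm, collapse_self⟩
  · have hxv : x ≠ v := by rintro rfl; exact hxS hH.mem_self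
    simp only [collapse, hxv, hxS, if_false] at hx0
    obtain ⟨y, hy, hy2⟩ := hR.2 x hx hx0
    by_cases hyS : y ∈ branch T u v
    · obtain ⟨rfl, rfl⟩ := eq_of_adj_of_notMem_branch hH.acyclic hH.adj hyS hxS hy.symm
      exact ⟨y, hy, collapse_self⟩
    · have hyv : y ≠ v := by rintro rfl; exact hyS hH.mem_self
      exact ⟨y, hy, by simp [collapse, hyv, hyS, hy2]⟩

variable [Fintype V]

open scoped Classical in
lemma IsHub.weight_collapse (hH : IsHub T X u v) (g : V → ℕ) :
    weight (collapse T u v g) + ∑ x with x ∈ branch T u v, g x = weight g + 2 := by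
  unfold weight
  rw [← Finset.sum_filter_add_sum_filter_not Finset.univ (fun x => x ∈ branch T u v) g,
    ← Finset.sum_filter_add_sum_filter_not Finset.univ (fun x => x ∈ branch T u v)
      (collapse T u v g)]
  have hin : ∑ x with x ∈ branch T u v, collapse T u v g x = 2 := by
    rw [Finset.sum_eq_single_of_mem v (by simpa using hH.mem_self), collapse_self]
    intro b hb hbv
    simp [collapse, hbv, (Finset.mem_filter_univ b).1 hb]
  have hout : ∑ x with x ∉ branch T u v, collapse T u v g x =
      ∑ x with x ∉ branch T u v, g x := by
    refine Finset.sum_congr rfl fun x hx => ?_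
    have hxS : x ∉ branch T u v := (Finset.mem_filter_univ x).1 hx
    have hxv : x ≠ v := by rintro rfl; exact hxS hH.mem_self
    simp [collapse, hxS, hxv]
  omega

lemma IsHub.weight_collapse_add_sum_le (hH : IsHub T X u v) (g : V → ℕ) {s : Finset V}
    (hs : ↑s ⊆ branch T u v) : weight (collapse T u v g) + ∑ x ∈ s, g x ≤ weight g + 2 := by
  classical
  rw [← hH.weight_collapse g]
  gcongr
  exact fun x hx => (Finset.mem_filter_univ x).2 (hs hx)

lemma IsHub.sum_le_two (hH : IsHub T X u v) (hg : IsMinWRDF T X g) (hR : IsRDF T X g)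
    {s : Finset V} (hs : ↑s ⊆ branch T u v) : ∑ x ∈ s, g x ≤ 2 := by
  have hle := hg.weight_le (hH.isRDF_collapse hR).isWRDF
  have hsum := hH.weight_collapse_add_sum_le g hs
  omega

lemma IsHub.add_le_two (hH : IsHub T X u v) (hg : IsMinWRDF T X g) (hR : IsRDF T X g) {a b : V}
    (ha : a ∈ branch T u v) (hb : b ∈ branch T u v) (hab : a ≠ b) : g a + g b ≤ 2 := by
  classical
  rw [← Finset.sum_pair hab]
  exact hH.sum_le_two hg hR (by simp [Set.insert_subset_iff, ha, hb])

lemma Strong.nontrivial_demands (hS : Strong T X) (hg : IsMinWRDF T X g) (hv : g v = 2) (u : V) :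
    (demands T X u v).Nontrivial := by
  obtain ⟨a, ha, hau, -⟩ := hS.exists_isPrivate hg hv u u
  obtain ⟨b, hb, hbu, hba⟩ := hS.exists_isPrivate hg hv u a
  exact ⟨a, ⟨⟨ha.2.1.symm, ha.1⟩, hau⟩, b, ⟨⟨hb.2.1.symm, hb.1⟩, hbu⟩, hba.symm⟩

lemma Strong.two_lt_ncard_demands (hS : Strong T X) (hg : IsMinWRDF T X g) (hv : g v = 2)
    (hu : u ∉ X) : 2 < (demands T X u v).ncard := by
  obtain ⟨a, ha, -⟩ := hS.exists_isPrivate hg hv u u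
  obtain ⟨b, hb, hba, -⟩ := hS.exists_isPrivate hg hv a a
  obtain ⟨c, hc, hca, hcb⟩ := hS.exists_isPrivate hg hv a b
  have hmem : ∀ {x}, IsPrivate T X g v x → x ∈ demands T X u v := fun hx =>
    ⟨⟨hx.2.1.symm, hx.1⟩, by rintro rfl; exact hu hx.1⟩
  exact (Set.two_lt_ncard_iff (Set.toFinite _)).2
    ⟨a, b, c, hmem ha, hmem hb, hmem hc, hba.symm, hca.symm, hcb.symm⟩

/-- If the branch at `v` carries weight `2`, then collapsing preserves minimality, and in the
collapsed function `v` has private neighbors. -/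
lemma IsHub.nontrivial_demands (hH : IsHub T X u v) (hS : Strong T X) (hg : IsMinWRDF T X g)
    {s : Finset V} (hs : ↑s ⊆ branch T u v) (hs2 : 2 ≤ ∑ x ∈ s, g x) :
    (demands T X u v).Nontrivial := by
  have hsum := hH.weight_collapse_add_sum_le g hs
  exact hS.nontrivial_demands
    (hg.of_weight_le (hH.isRDF_collapse (hS g hg)).isWRDF (by omega)) collapse_self u

lemma IsHub.apply_ne_one (hH : IsHub T X u v) (hS : Strong T X) (hg : IsMinWRDF T X g) :
    g v ≠ 1 := fun hv => by
  classical
  have hR := hS g hg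
  have hpos : ∀ w ∈ demands T X u v, 1 ≤ g w := fun w hw => by
    rcases hH.pos_or_exists_two hR hw with h | ⟨p, hp, -, hp2⟩
    · exact h
    · have hpv : p ≠ v := by rintro rfl; omega
      have := hH.add_le_two hg hR hp hH.mem_self hpv
      omega
  obtain ⟨w, hw⟩ := hH.demands_nonempty
  have hw1 := hpos w hw
  obtain ⟨a, ha, b, hb, hab⟩ := hH.nontrivial_demands hS hg (s := {v, w})
    (by simp [Set.insert_subset_iff, hH.mem_self, hH.demands_subset hw])
    (by rw [Finset.sum_pair hw.1.1.ne]; omega)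
  have hsum := hH.sum_le_two hg hR (s := {v, a, b})
    (by simp [Set.insert_subset_iff, hH.mem_self, hH.demands_subset ha, hH.demands_subset hb])
  rw [Finset.sum_insert (by simp [ha.1.1.ne, hb.1.1.ne]), Finset.sum_pair hab] at hsum
  have ha1 := hpos a ha
  have hb1 := hpos b hb
  omega

lemma IsHub.apply_ne_zero (hH : IsHub T X u v) (hS : Strong T X) (hg : IsMinWRDF T X g) :
    g v ≠ 0 := fun hv => by
  have hR := hS g hg
  have hcov : ∀ w ∈ demands T X u v, ∃ p ∈ branch T u v, (p = w ∨ T.Adj w p) ∧ g p = 2 := by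
    intro w hw
    have hw1 : g w ≠ 1 := fun h => hS.apply_ne_zero_of_adj hg hw.1.1.symm h hv
    have hw2 := hg.1.le_two w
    rcases hH.pos_or_exists_two hR hw with h | ⟨p, hp, hwp, hp2⟩
    · exact ⟨w, hH.demands_subset hw, Or.inl rfl, by omega⟩
    · exact ⟨p, hp, Or.inr hwp, hp2⟩
  obtain ⟨w, hw⟩ := hH.demands_nonempty
  obtain ⟨p, hp, -, hp2⟩ := hcov w hw
  obtain ⟨a, ha, b, hb, hab⟩ := hH.nontrivial_demands hS hg (s := {p}) (by simpa using hp)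
    (by simp [hp2])
  obtain ⟨q, hq, haq, hq2⟩ := hcov a ha
  obtain ⟨r, hr, hbr, hr2⟩ := hcov b hb
  obtain rfl : q = r := by
    by_contra hqr
    have := hH.add_le_two hg hR hq hr hqr
    omega
  have hindep := isIndepSet_neighborSet hH.acyclic v
  have hqv : q ≠ v := by rintro rfl; omega
  rcases haq with rfl | haq
  · exact hindep hb.1.1 ha.1.1 hab.symm (hbr.resolve_left hab)
  rcases hbr with rfl | hbq
  · exact hindep ha.1.1 hb.1.1 hab haq
  · exact hab (eq_of_common_neighbors hH.acyclic ha.1.1 hb.1.1 haq hbq hqv)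

lemma IsHub.apply_eq_two (hH : IsHub T X u v) (hS : Strong T X) (hg : IsMinWRDF T X g) :
    g v = 2 := by
  have h0 := hH.apply_ne_zero hS hg
  have h1 := hH.apply_ne_one hS hg
  have h2 := hg.1.le_two v
  omega

lemma IsHub.apply_eq_zero (hH : IsHub T X u v) (hS : Strong T X) (hg : IsMinWRDF T X g) {x : V}
    (hx : x ∈ branch T u v) (hxv : x ≠ v) : g x = 0 := by
  have hsum := hH.add_le_two hg (hS g hg) hx hH.mem_self hxv
  have hv := hH.apply_eq_two hS hg
  omega

lemma IsHub.mem_coverable (hH : IsHub T X u v) (hS : Strong T X) {x : V}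
    (hx : x = v ∨ T.Adj v x) : x ∈ coverable T X := by
  obtain ⟨g, hg⟩ := exists_isMinWRDF T X
  have hv := hH.apply_eq_two hS hg
  rcases hx with rfl | hx
  · exact ⟨g, hg, Or.inl (by omega)⟩
  · exact mem_coverable_of_adj_two hg hx.symm hv

lemma IsHub.adj_of_mem_coverable (hH : IsHub T X u v) (hS : Strong T X) {x : V}
    (hx : x ∈ branch T u v) (hxv : x ≠ v) (hc : x ∈ coverable T X) : T.Adj v x := by
  obtain ⟨g, hg, hpos | ⟨-, hdef⟩⟩ := hc
  · have := hH.apply_eq_zero hS hg hx hxv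
    omega
  · obtain ⟨y, hxy, hy, -⟩ := isDefended_iff.1 hdef
    have hyS := mem_branch_of_adj_of_ne hH.acyclic hH.adj hx hxv hxy
    by_cases hyv : y = v
    · exact hyv ▸ hxy.symm
    · have := hH.apply_eq_zero hS hg hyS hyv
      omega

end Hub

section Configuration

lemma exists_enumeration {V : Type*} {s t : Set V} [Finite s] [Finite t] (hst : Disjoint s t) :
    ∃ w : Fin (s.ncard + t.ncard) → V, Function.Injective w ∧ Set.range w = s ∪ t ∧
      ∀ i, w i ∈ s ↔ (i : ℕ) < s.ncard := by
  let e : Fin s.ncard ≃ s := (Finite.equivFinOfCardEq (Nat.card_coe_set_eq s)).symm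
  let f : Fin t.ncard ≃ t := (Finite.equivFinOfCardEq (Nat.card_coe_set_eq t)).symm
  have he : ∀ i, (e i : V) ∈ s := fun i => (e i).2
  have hf : ∀ i, (f i : V) ∉ s := fun i => hst.notMem_of_mem_right (f i).2
  refine ⟨Sum.elim (fun i => (e i : V)) (fun i => (f i : V)) ∘ finSumFinEquiv.symm,
    (Function.Injective.sumElim (Subtype.val_injective.comp e.injective)
      (Subtype.val_injective.comp f.injective)
      fun i j (h : (e i : V) = f j) => hf j (h ▸ he i)).comp finSumFinEquiv.symm.injective,
      ?_, fun i => ?_⟩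
  · rw [EquivLike.range_comp, Set.Sum.elim_range]
    simp only [← Function.comp_def Subtype.val, EquivLike.range_comp, Subtype.range_coe]
  · obtain ⟨j | j, rfl⟩ := finSumFinEquiv.surjective i
    · simp [he]
    · simp [hf]

variable {A : Triple.{u}} {u v : A.V} {k : ℕ} {w : Fin k → A.V}

lemma IsHub.branch_inter_subset (hH : IsHub A.T A.X u v) {x : A.V} (hvx : A.T.Adj v x)
    (hxu : x ≠ u) : branch A.T v x ∩ A.X ⊆ {x} := by
  rintro y ⟨hy, hyX⟩
  have hyv := ne_of_mem_branch hy
  exact eq_of_mem_branch_of_adj hH.acyclic hvx hy ((hH.near y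
    (branch_subset_branch hH.acyclic hH.adj hvx hxu hy) hyX).resolve_left hyv)

lemma IsHub.branch_inter_coverable (hH : IsHub A.T A.X u v) (hS : Strong A.T A.X) {x : A.V}
    (hvx : A.T.Adj v x) (hxu : x ≠ u) : branch A.T v x ∩ coverable A.T A.X = {x} := by
  refine Set.Subset.antisymm ?_
    (Set.singleton_subset_iff.2 ⟨mem_branch_self hvx.ne', hH.mem_coverable hS (Or.inr hvx)⟩)
  rintro y ⟨hy, hyc⟩
  exact eq_of_mem_branch_of_adj hH.acyclic hvx hy (hH.adj_of_mem_coverable hS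
    (branch_subset_branch hH.acyclic hH.adj hvx hxu hy) (ne_of_mem_branch hy) hyc)

lemma IsHub.exists_isConfiguration (hH : IsHub A.T A.X u v) (hS : Strong A.T A.X)
    (hY : A.Y = coverable A.T A.X) :
    ∃ (k : ℕ) (w : Fin k → A.V), A.IsConfiguration u v k w := by
  obtain ⟨g, hg⟩ := exists_isMinWRDF A.T A.X
  have hv := hH.apply_eq_two hS hg
  have h1 : 1 < (demands A.T A.X u v).ncard :=
    Set.one_lt_ncard_iff_nontrivial.2 (hS.nontrivial_demands hg hv u)
  obtain ⟨w, hinj, hrange, hlt⟩ := exists_enumeration (s := demands A.T A.X u v)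
    (t := demands A.T A.Xᶜ u v) (Set.disjoint_left.2 fun x hx hx' => hx'.1.2 hx.1.2)
  have hrange' : Set.range w = A.T.neighborSet v \ {u} := by
    rw [hrange, demands, demands, ← Set.union_sdiff_distrib, Set.inter_union_compl]
  have hw : ∀ i, A.T.Adj v (w i) ∧ w i ≠ u := fun i => hrange'.subset ⟨i, rfl⟩
  have hX : ∀ i, branch A.T v (w i) ∩ A.X ⊆ {w i} := fun i =>
    hH.branch_inter_subset (hw i).1 (hw i).2
  refine ⟨_, w, hinj, ?_, ?_, _, h1.le, Nat.le_add_right _ _, fun i hi => ?_, fun i hi => ?_, ?_⟩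
  · exact fun hu => (hrange'.subset hu).2 rfl
  · rw [hrange', Set.union_sdiff_self, eq_comm, Set.union_eq_right, Set.singleton_subset_iff]
    exact hH.adj.symm
  · exact (hX i).antisymm
      (Set.singleton_subset_iff.2 ⟨mem_branch_self (hw i).1.ne', ((hlt i).2 hi).1.2⟩)
  · refine Set.eq_empty_of_forall_notMem fun x hx => ?_
    obtain rfl : x = w i := hX i hx
    exact hi.not_gt ((hlt i).1 ⟨⟨(hw i).1, hx.2⟩, (hw i).2⟩)
  · have huY := hH.mem_coverable hS (Or.inr hH.adj.symm)
    have hvY := hH.mem_coverable hS (Or.inl rfl)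
    have hwY := fun i => hH.branch_inter_coverable hS (hw i).1 (hw i).2
    rw [hY]
    rcases Nat.lt_or_ge 2 (demands A.T A.X u v).ncard with h2 | h2
    · exact Or.inr ⟨h2, huY, hvY, hwY⟩
    · refine Or.inl ⟨by omega, ?_, huY, hvY, hwY⟩
      by_contra huX
      exact h2.not_gt (hS.two_lt_ncard_demands hg hv huX)

lemma Triple.IsConfiguration.adj_iff (hC : A.IsConfiguration u v k w) {x : A.V} :
    A.T.Adj v x ↔ x = u ∨ ∃ i, w i = x := by
  rw [← SimpleGraph.mem_neighborSet, hC.2.2.1]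
  simp

lemma Triple.IsConfiguration.isHub (hC : A.IsConfiguration u v k w) (hT : A.T.IsAcyclic) :
    IsHub A.T A.X u v := by
  obtain ⟨ℓ, h1, hk, hlt, hge, -⟩ := hC.2.2.2
  have hX : ∀ i, branch A.T v (w i) ∩ A.X ⊆ {w i} := fun i => by
    rcases lt_or_ge (i : ℕ) ℓ with hi | hi
    · exact (hlt i hi).subset
    · exact (hge i hi).subset.trans (Set.empty_subset _)
  refine ⟨hT, (hC.adj_iff.2 (Or.inl rfl)).symm, fun x hx hxX => ?_, ?_⟩
  · refine (eq_or_exists_mem_branch hx).imp_right ?_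
    rintro ⟨y, hy, hyu, hxy⟩
    obtain ⟨i, rfl⟩ := (hC.adj_iff.1 hy).resolve_left hyu
    obtain rfl : x = w i := hX i ⟨hxy, hxX⟩
    exact hy
  · let i : Fin k := ⟨0, by omega⟩
    have hwi : w i ∈ branch A.T v (w i) ∩ A.X := (hlt i h1).superset rfl
    exact ⟨w i, ⟨hC.adj_iff.2 (Or.inr ⟨i, rfl⟩), hwi.2⟩, fun h => hC.2.1 ⟨i, h⟩⟩

end Configuration

section Arises

variable {V W : Type u} {G : SimpleGraph V} {H : SimpleGraph W} {φ : V ↪ W} {u : V} {v : W}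
  {N L : Set W} {E : Set (Sym2 W)}

lemma arisesByAdding_iff : ArisesByAdding G H φ N E ↔
    (Set.range φ)ᶜ = N ∧ ∀ x y, H.Adj x y ↔ (G.map φ).Adj x y ∨ s(x, y) ∈ E := by
  refine and_congr_right' ?_
  have hmap : Sym2.map φ '' G.edgeSet = (G.map φ).edgeSet := (SimpleGraph.edgeSet_map φ G).symm
  rw [hmap, Set.ext_iff, Sym2.forall]
  rfl

lemma ArisesByAdding.le (h : ArisesByAdding G H φ N E) : G.map φ ≤ H := fun x y hxy =>
  ((arisesByAdding_iff.1 h).2 x y).2 (.inl hxy)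

lemma ArisesByAdding.connected (h : ArisesByAdding G H φ N E) (hG : G.Connected)
    (hN : ∀ x ∈ N, ∃ a, H.Reachable (φ a) x) : H.Connected := by
  have hφ : ∀ a b, H.Reachable (φ a) (φ b) := fun a b =>
    (((hG.preconnected a b).map (SimpleGraph.Embedding.map φ G).toHom).mono h.le)
  have hr : ∀ x, ∃ a, H.Reachable (φ a) x := fun x => by
    by_cases hx : x ∈ Set.range φ
    · obtain ⟨a, rfl⟩ := hx
      exact ⟨a, .refl _⟩
    · exact hN x (h.1 ▸ hx)
  have : Nonempty W := hG.nonempty.map φ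
  refine ⟨fun x y => ?_⟩
  obtain ⟨a, ha⟩ := hr x
  obtain ⟨b, hb⟩ := hr y
  exact ha.symm.trans ((hφ a b).trans hb)

lemma ArisesByAdding.isTree [Finite W] (h : ArisesByAdding G H φ N E) (hG : G.IsTree)
    (hE : E.ncard ≤ N.ncard) (hN : ∀ x ∈ N, ∃ a, H.Reachable (φ a) x) : H.IsTree := by
  have : Finite V := .of_injective φ φ.injective
  have hconn := h.connected hG.connected hN
  rw [SimpleGraph.isTree_iff_connected_and_card] at hG ⊢
  refine ⟨hconn, le_antisymm ?_ hconn.card_vert_le_card_edgeSet_add_one⟩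
  have hedges : Nat.card H.edgeSet ≤ Nat.card G.edgeSet + E.ncard := by
    rw [Nat.card_coe_set_eq, h.2, Nat.card_coe_set_eq]
    exact (Set.ncard_union_le _ _).trans (Nat.add_le_add_right Set.ncard_image_le _)
  have hverts : Nat.card W = Nat.card V + N.ncard := by
    rw [← h.1, ← Set.ncard_add_ncard_compl (Set.range φ), ← Set.image_univ,
      Set.ncard_image_of_injective _ φ.injective, Set.ncard_univ]
  omega

/-- The edges of a star with center `v` and endvertices `L`, attached to `x`. -/
def starEdges (x v : W) (L : Set W) : Set (Sym2 W) := insert s(x, v) ((fun w => s(v, w)) '' L)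

lemma mem_starEdges {x v a b : W} : s(a, b) ∈ starEdges x v L ↔
    (a = x ∧ b = v) ∨ (a = v ∧ b = x) ∨ (a = v ∧ b ∈ L) ∨ (b = v ∧ a ∈ L) := by
  simp only [starEdges, Set.mem_insert_iff, Sym2.eq_iff, Set.mem_image]
  grind

lemma StarExt.adj_iff_map_adj_or (P : StarExt G H φ u v) (hL : (Set.range φ)ᶜ = insert v L)
    (hv : v ∉ L) (x y : W) :
    H.Adj x y ↔ (G.map φ).Adj x y ∨ s(x, y) ∈ starEdges (φ u) v L := by
  have hnew : ∀ x, x ∉ Set.range φ ↔ x = v ∨ x ∈ L := Set.ext_iff.1 hL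
  obtain ⟨⟨hadj, hadj_new, hvr⟩, hcenter, hleaves⟩ := P
  rw [mem_starEdges, SimpleGraph.map_adj]
  by_cases hx : x ∈ Set.range φ
  · obtain ⟨a, rfl⟩ := hx
    by_cases hy : y ∈ Set.range φ
    · obtain ⟨b, rfl⟩ := hy
      grind
    · grind
  · by_cases hy : y ∈ Set.range φ
    · obtain ⟨b, rfl⟩ := hy
      grind [H.adj_comm]
    · grind [H.adj_comm, H.irrefl]

lemma StarExt.arisesByAdding (P : StarExt G H φ u v) (hL : (Set.range φ)ᶜ = insert v L)
    (hv : v ∉ L) : ArisesByAdding G H φ (insert v L) (starEdges (φ u) v L) :=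
  arisesByAdding_iff.2 ⟨hL, P.adj_iff_map_adj_or hL hv⟩

lemma ArisesByAdding.starExt (h : ArisesByAdding G H φ (insert v L) (starEdges (φ u) v L)) :
    StarExt G H φ u v := by
  obtain ⟨hL, hadj⟩ := arisesByAdding_iff.1 h
  have hnew : ∀ x, x ∉ Set.range φ ↔ x = v ∨ x ∈ L := Set.ext_iff.1 hL
  simp only [mem_starEdges, SimpleGraph.map_adj] at hadj
  exact ⟨⟨fun a b => by grind, by grind, by grind⟩, by grind, by grind⟩

lemma ArisesByAdding.isTree_of_star [Finite W]
    (h : ArisesByAdding G H φ (insert v L) (starEdges (φ u) v L)) (hv : v ∉ L) (hG : G.IsTree) :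
    H.IsTree := by
  have P := h.starExt
  refine h.isTree hG ?_ fun x hx => ⟨u, ?_⟩
  · rw [Set.ncard_insert_of_notMem hv]
    exact (Set.ncard_insert_le _ _).trans (Nat.add_le_add_right Set.ncard_image_le _)
  · rcases eq_or_ne x v with rfl | hxv
    · exact P.adj.reachable
    · rw [← h.1] at hx
      exact P.adj.reachable.trans (P.adj_center x hx hxv).symm.reachable

lemma starEdges_empty (x v : W) : starEdges x v ∅ = {s(x, v)} := by simp [starEdges]

lemma starEdges_pair (x v w₁ w₂ : W) :
    starEdges x v {w₁, w₂} = {s(x, v), s(v, w₁), s(v, w₂)} := by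
  simp [starEdges, Set.image_insert_eq]

lemma starEdges_triple (x v w₁ w₂ w₃ : W) :
    starEdges x v {w₁, w₂, w₃} = {s(x, v), s(v, w₁), s(v, w₂), s(v, w₃)} := by
  simp [starEdges, Set.image_insert_eq]

lemma LeafExt.starExt (P : LeafExt G H φ u v) : StarExt G H φ u v :=
  ⟨P.toPendantExt, fun x hx hxv => absurd (P.eq_of_notMem x hx) hxv,
    fun x _ hx hxv _ _ => absurd (P.eq_of_notMem x hx) hxv⟩

lemma LeafExt.arisesByAdding (P : LeafExt G H φ u v) :
    ArisesByAdding G H φ {v} {s(φ u, v)} := by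
  have hr : (Set.range φ)ᶜ = {v} :=
    Set.eq_singleton_iff_unique_mem.2 ⟨P.notMem, fun x hx => P.eq_of_notMem x hx⟩
  have h := P.starExt.arisesByAdding (L := ∅) (by rw [hr, insert_empty_eq]) (Set.notMem_empty v)
  rwa [starEdges_empty, insert_empty_eq] at h

lemma ArisesByAdding.leafExt (h : ArisesByAdding G H φ {v} {s(φ u, v)}) :
    LeafExt G H φ u v := by
  rw [← insert_empty_eq v, ← starEdges_empty] at h
  exact ⟨h.starExt.toPendantExt, fun x hx => by simpa [h.1] using Set.mem_compl hx⟩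

lemma ArisesByAdding.isTree_of_leaf [Finite W] (h : ArisesByAdding G H φ {v} {s(φ u, v)})
    (hG : G.IsTree) : H.IsTree := by
  rw [← insert_empty_eq v, ← starEdges_empty] at h
  exact h.isTree_of_star (Set.notMem_empty v) hG

end Arises

section EmptyDemand

variable {V : Type*} [Fintype V] {G : SimpleGraph V}

lemma IsMinWRDF.apply_eq_zero_of_empty {g : V → ℕ} (hg : IsMinWRDF G ∅ g) (x : V) : g x = 0 := by
  have h0 : IsWRDF G ∅ (fun _ : V => 0) := ⟨fun _ => Or.inl rfl, fun _ => False.elim⟩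
  have hg0 : weight g = 0 := Nat.le_zero.1 ((hg.weight_le h0).trans_eq Finset.sum_const_zero)
  exact Finset.sum_eq_zero_iff.1 hg0 x (Finset.mem_univ x)

lemma coverable_empty : coverable G ∅ = ∅ := by
  refine Set.eq_empty_of_forall_notMem ?_
  rintro x ⟨g, hg, hx | ⟨-, y, -, hy, -⟩⟩
  · exact (Nat.one_le_iff_ne_zero.1 hx) (hg.apply_eq_zero_of_empty x)
  · exact (Nat.one_le_iff_ne_zero.1 hy) (hg.apply_eq_zero_of_empty y)

lemma strong_empty : Strong G ∅ := fun _ hg => ⟨hg.1.1, fun _ => False.elim⟩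

end EmptyDemand

section Forward

variable {A B : Triple.{u}} {φ : A.V ↪ B.V} {u : A.V} {v z : B.V} {L : Set B.V}

lemma mem_setS_iff : A ∈ setS ↔ A.T.IsTree ∧ Strong A.T A.X ∧ A.Y = coverable A.T A.X := Iff.rfl

lemma mem_setS_of_leaf (hA : A ∈ setS) (hadd : ArisesByAdding A.T B.T φ {z} {s(φ u, z)})
    (hu : ∀ g, IsMinWRDF A.T A.X g → g u = 0) (hX : B.X = φ '' A.X) (hY : B.Y = φ '' A.Y) :
    B ∈ setS := by
  obtain ⟨hT, hS, hAY⟩ := mem_setS_iff.1 hA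
  have P := hadd.leafExt
  have hS' := P.strong hS (isIndepSet_neighborSet hT.isAcyclic u) fun g hg => by simp [hu g hg]
  refine mem_setS_iff.2 ⟨hadd.isTree_of_leaf hT, hX ▸ hS', ?_⟩
  rw [hX, hY, hAY, P.coverable_eq_of_never_two hS' fun g hg => by simp [hu g hg]]

lemma mem_setS_of_star (hA : A ∈ setS)
    (hadd : ArisesByAdding A.T B.T φ (insert v L) (starEdges (φ u) v L)) (hv : v ∉ L)
    (D : DemandExt φ u A.X B.X) (hN : (demandingLeaves φ v B.X).Nontrivial)
    (h2 : ∀ h, IsMinWRDF B.T B.X h → h v = 2)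
    (hY : B.Y = φ '' A.Y ∪ insert (φ u) (insert v L)) : B ∈ setS := by
  obtain ⟨hT, hS, hAY⟩ := mem_setS_iff.1 hA
  have P := hadd.starExt
  refine mem_setS_iff.2 ⟨hadd.isTree_of_star hv hT, P.strong D hN h2 hS, ?_⟩
  rw [P.coverable_eq D hN h2, hY, hAY, hadd.1, Set.union_assoc, Set.singleton_union]

lemma Op1.mem_setS (hA : A ∈ setS) (h : Op1 A B) : B ∈ setS := by
  obtain ⟨-, φ, u, v, hu, hadd, hBX, hBY⟩ := h
  rw [(mem_setS_iff.1 hA).2.2] at hu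
  exact mem_setS_of_leaf hA hadd (fun g hg => apply_eq_zero_of_notMem_coverable hg hu) hBX hBY

lemma Op5.mem_setS (hA : A ∈ setS) (h : Op5 A B) : B ∈ setS := by
  obtain ⟨hT, hS, -⟩ := mem_setS_iff.1 hA
  obtain ⟨-, φ, u, v, k, w, i, z, hC, hadd, hBX, hBY⟩ := h
  have hvw : A.T.Adj v (w i) := hC.adj_iff.2 (Or.inr ⟨i, rfl⟩)
  have hH := hC.isHub hT.isAcyclic
  have hw : w i ∈ branch A.T u v := hH.mem_of_adj hvw fun h => hC.2.1 ⟨i, h⟩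
  exact mem_setS_of_leaf hA hadd (fun g hg => hH.apply_eq_zero hS hg hw hvw.ne') hBX hBY

lemma Op4.mem_setS (hA : A ∈ setS) (h : Op4 A B) : B ∈ setS := by
  obtain ⟨hT, hS, hY⟩ := mem_setS_iff.1 hA
  obtain ⟨-, φ, u, v, k, w, z, hC, hadd, hBX, hBY⟩ := h
  have P := hadd.leafExt
  have h2 : ∀ g, IsMinWRDF A.T A.X g → g v = 2 := fun g hg =>
    (hC.isHub hT.isAcyclic).apply_eq_two hS hg
  have hS' := P.strong hS (isIndepSet_neighborSet hT.isAcyclic v) fun g hg => by simp [h2 g hg]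
  have hc : coverable B.T (φ '' A.X) = φ '' coverable A.T A.X ∪ {z} := by
    obtain ⟨g, hg⟩ := exists_isMinWRDF A.T A.X
    exact P.coverable_eq_of_two hS' ⟨g, hg, h2 g hg⟩
  refine mem_setS_iff.2 ⟨hadd.isTree_of_leaf hT, ?_⟩
  rcases hBX with hBX | hBX
  · rw [hBX, hBY, hY, hc]
    exact ⟨hS', rfl⟩
  · have h2' : ∀ h, IsMinWRDF B.T (φ '' A.X) h → h (φ v) = 2 := fun h hh =>
      h2 _ (P.isMinWRDF_comp hh (P.apply_eq_zero_of_strong hS' hh))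
    rw [hBX, Set.union_singleton, hBY, hY, coverable_insert P.adj.symm h2', hc]
    exact ⟨hS'.insert P.adj.symm h2', rfl⟩

lemma Op2.mem_setS (hA : A ∈ setS) (h : Op2 A B) : B ∈ setS := by
  obtain ⟨-, φ, u, v, w₁, w₂, hu, hnd, hadd, hBX, hBY⟩ := h
  obtain ⟨S, hBX, hS, hS'⟩ :
      ∃ S, B.X = φ '' A.X ∪ S ∧ {φ u, w₁, w₂} ⊆ S ∧ S ⊆ {φ u, v, w₁, w₂} := by
    rcases hBX with h | h
    exacts [⟨_, h, subset_rfl, by grind⟩, ⟨_, h, by grind, subset_rfl⟩]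
  rw [(mem_setS_iff.1 hA).2.2] at hu
  rw [← starEdges_pair] at hadd
  have hv : v ∉ ({w₁, w₂} : Set B.V) := by grind
  have D : DemandExt φ u A.X B.X := by
    rw [hBX]
    exact demandExt_union (fun h => hu (subset_coverable _ _ h)) (by rwa [hadd.1])
  have hN : (demandingLeaves φ v B.X).Nontrivial := by
    rw [demandingLeaves_eq_inter hadd.1 hv]
    exact ⟨w₁, by grind, w₂, by grind, by grind⟩
  exact mem_setS_of_star hA hadd hv D hN
    (fun h hh => hadd.starExt.center_eq_two_of_two D hN (by grind) hu hh) hBY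

lemma Op3.mem_setS (hA : A ∈ setS) (h : Op3 A B) : B ∈ setS := by
  obtain ⟨-, φ, u, v, w₁, w₂, w₃, hu, hnd, hadd, hBX, hBY⟩ := h
  obtain ⟨S, hBX, hS, hS'⟩ :
      ∃ S, B.X = φ '' A.X ∪ S ∧ {w₁, w₂, w₃} ⊆ S ∧ S ⊆ {φ u, v, w₁, w₂, w₃} := by
    rcases hBX with h | h | h | h
    exacts [⟨_, h, subset_rfl, by grind⟩, ⟨_, h, by grind, by grind⟩,
      ⟨_, h, by grind, by grind⟩, ⟨_, h, by grind, subset_rfl⟩]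
  rw [← starEdges_triple] at hadd
  have hv : v ∉ ({w₁, w₂, w₃} : Set B.V) := by grind
  have D : DemandExt φ u A.X B.X := by
    rw [hBX]
    exact demandExt_union hu (by rwa [hadd.1])
  have hN : 2 < (demandingLeaves φ v B.X).ncard := by
    rw [demandingLeaves_eq_inter hadd.1 hv, Set.inter_eq_right.2 (by grind),
      Set.ncard_eq_three.2 ⟨w₁, w₂, w₃, by grind, by grind, by grind, rfl⟩]
    exact Nat.lt_succ_self 2
  exact mem_setS_of_star hA hadd hv D (Set.one_lt_ncard_iff_nontrivial.1 (by omega))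
    (fun h hh => hadd.starExt.center_eq_two_of_three D hN hh) hBY

lemma mem_setS_of_card_eq_one (hV : Fintype.card A.V = 1) (hS : Strong A.T A.X)
    (hY : A.Y = coverable A.T A.X) : A ∈ setS := by
  have := Fintype.card_le_one_iff_subsingleton.1 hV.le
  have : Nonempty A.V := Fintype.card_pos_iff.1 (hV ▸ Nat.one_pos)
  exact mem_setS_iff.2 ⟨SimpleGraph.IsTree.of_subsingleton, hS, hY⟩

lemma strong_of_subsingleton {V : Type*} [Fintype V] [Subsingleton V] {G : SimpleGraph V}
    {X : Set V} : Strong G X := fun g hg => ⟨hg.1.1, fun x hx hx0 => by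
  obtain ⟨y, hxy, -⟩ := hg.1.2 x hx hx0
  exact absurd (Subsingleton.elim x y) hxy.ne⟩

lemma Generated.mem_setS (h : Generated A) : A ∈ setS := by
  induction h with
  | base_empty A hV hX hY =>
    exact mem_setS_of_card_eq_one hV (hX ▸ strong_empty) (by rw [hX, hY, coverable_empty])
  | base_full A hV hX hY =>
    have := Fintype.card_le_one_iff_subsingleton.1 hV.le
    refine mem_setS_of_card_eq_one hV strong_of_subsingleton ?_
    rw [hY, eq_comm, ← Set.univ_subset_iff, ← hX]
    exact subset_coverable _ _
  | step A B _ hAB ih =>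
    rcases hAB with h | h | h | h | h
    exacts [h.mem_setS ih, h.mem_setS ih, h.mem_setS ih, h.mem_setS ih, h.mem_setS ih]

end Forward

section Restriction

variable {V W : Type*} {G : SimpleGraph V} {H : SimpleGraph W} {φ : V ↪ W} {u : V} {v : W}

lemma mem_of_connected (hG : G.Connected) {C : Set V} {x : V} (hx : x ∈ C)
    (hC : ∀ a ∈ C, ∀ b, G.Adj a b → b ∈ C) (y : V) : y ∈ C := by
  obtain ⟨p⟩ := hG.preconnected x y
  induction p with
  | nil => exact hx
  | cons h _ ih => exact ih (hC _ hx _ h)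

lemma PendantExt.isAcyclic (P : PendantExt G H φ u v) (hH : H.IsAcyclic) : G.IsAcyclic :=
  hH.comap ⟨φ, (P.adj_iff _ _).2⟩ φ.injective

lemma PendantExt.connected (P : PendantExt G H φ u v) (hH : H.Connected) : G.Connected := by
  have hu : ∀ x b, φ b = x → G.Reachable u b := by
    refine mem_of_connected hH (C := {x | ∀ b, φ b = x → G.Reachable u b}) (x := φ u)
      (fun b hb => by rw [φ.injective hb]) ?_
    rintro x hx _ hxy b rfl
    by_cases hxr : x ∈ Set.range φ
    · obtain ⟨c, rfl⟩ := hxr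
      exact (hx c rfl).trans ((P.adj_iff _ _).1 hxy).reachable
    · rw [((P.adj_new_iff b x hxr).1 hxy.symm).1]
  have : Nonempty V := ⟨u⟩
  exact ⟨fun a b => (hu _ a rfl).symm.trans (hu _ b rfl)⟩

lemma PendantExt.isTree (P : PendantExt G H φ u v) (hH : H.IsTree) : G.IsTree :=
  ⟨P.connected hH.connected, P.isAcyclic hH.isAcyclic⟩

lemma PendantExt.card_lt [Fintype V] [Fintype W] (P : PendantExt G H φ u v) :
    Fintype.card V < Fintype.card W :=
  Fintype.card_lt_of_injective_of_notMem φ φ.injective P.notMem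

lemma PendantExt.apply_mem_branch (P : PendantExt G H φ u v) {a b x : V}
    (hx : x ∈ branch G a b) : φ x ∈ branch H (φ a) (φ b) := by
  suffices h : branch G a b ⊆ φ ⁻¹' branch H (φ a) (φ b) from h hx
  exact branch_subset (mem_branch_self (φ.injective.ne hx.1)) fun c hc d hcd hda =>
    mem_branch_of_adj hc ((P.adj_iff _ _).2 hcd) (φ.injective.ne hda)

lemma PendantExt.isHub (P : PendantExt G H φ u v) {X : Set V} {a b : V}
    (hH : IsHub H (φ '' X) (φ a) (φ b)) : IsHub G X a b := by
  refine ⟨P.isAcyclic hH.acyclic, (P.adj_iff _ _).1 hH.adj, fun x hx hxX => ?_, ?_⟩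
  · have := hH.near (φ x) (P.apply_mem_branch hx) ⟨x, hxX, rfl⟩
    rwa [φ.injective.eq_iff, P.adj_iff] at this
  · obtain ⟨_, ⟨hw, w, hwX, rfl⟩, hwa⟩ := hH.demands_nonempty
    exact ⟨w, ⟨(P.adj_iff _ _).1 hw, hwX⟩, fun h => hwa (congrArg φ h)⟩

lemma exists_pendantExt {W : Type u} {H : SimpleGraph W} {S : Set W} {u v : W} (hu : u ∉ S)
    (huv : H.Adj u v) (hv : v ∈ S) (hS : ∀ a ∉ S, ∀ x ∈ S, H.Adj a x → a = u ∧ x = v) :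
    ∃ (V : Type u) (G : SimpleGraph V) (φ : V ↪ W) (a : V),
      φ a = u ∧ PendantExt G H φ a v ∧ (Set.range φ)ᶜ = S := by
  let φ := Function.Embedding.subtype (· ∉ S)
  have hr : ∀ x, x ∉ Set.range φ ↔ x ∈ S := by simp [φ]
  refine ⟨{x // x ∉ S}, H.comap φ, φ, ⟨u, hu⟩, rfl,
    ⟨fun _ _ => Iff.rfl, fun a x hx => ⟨fun h => ?_, ?_⟩, (hr v).2 hv⟩, Set.ext hr⟩
  · exact (hS a a.2 x ((hr x).1 hx) h).imp_left Subtype.ext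
  · rintro ⟨rfl, rfl⟩
    exact huv

/-- `z` is an endvertex with neighbor `p`. -/
structure IsEndvertex (H : SimpleGraph W) (p z : W) : Prop where
  adj : H.Adj z p
  eq_of_adj : ∀ y, H.Adj z y → y = p

lemma exists_leafExt {W : Type u} {H : SimpleGraph W} {p z : W} (hz : IsEndvertex H p z) :
    ∃ (V : Type u) (G : SimpleGraph V) (φ : V ↪ W) (a : V),
      φ a = p ∧ LeafExt G H φ a z := by
  obtain ⟨V, G, φ, a, ha, P, hr⟩ := exists_pendantExt (S := {z}) hz.adj.ne' hz.adj.symm rfl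
    (by rintro a - _ rfl h; exact ⟨hz.eq_of_adj a h.symm, rfl⟩)
  exact ⟨V, G, φ, a, ha, P, fun x hx => hr.subset hx⟩

lemma exists_starExt {W : Type u} {H : SimpleGraph W} {u v : W} (huv : H.Adj v u)
    (hL : ∀ w, H.Adj v w → w ≠ u → IsEndvertex H v w) :
    ∃ (V : Type u) (G : SimpleGraph V) (φ : V ↪ W) (a : V),
      φ a = u ∧ StarExt G H φ a v ∧ (Set.range φ)ᶜ = insert v (H.neighborSet v \ {u}) := by
  have hL' : ∀ w ∈ H.neighborSet v \ {u}, IsEndvertex H v w := fun w hw => hL w hw.1 hw.2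
  obtain ⟨V, G, φ, a, ha, P, hr⟩ := exists_pendantExt (S := insert v (H.neighborSet v \ {u}))
    (by simp [huv.ne']) huv.symm (Set.mem_insert _ _) fun a ha x hx hax => by
      rcases hx with rfl | hx
      · grind [SimpleGraph.mem_neighborSet, H.adj_comm]
      · exact absurd ((hL' x hx).eq_of_adj a hax.symm) fun h => ha (Or.inl h)
  have hnew : ∀ x, x ∉ Set.range φ → x ≠ v → IsEndvertex H v x := fun x hx hxv =>
    hL' x ((hr.subset hx).resolve_left hxv)
  exact ⟨V, G, φ, a, ha, ⟨P, fun x hx hxv => (hnew x hx hxv).adj,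
    fun x y hx hxv _ hyv h => hyv ((hnew x hx hxv).eq_of_adj y h)⟩, hr⟩

end Restriction

section Search

variable {V : Type*} {T : SimpleGraph V} {X : Set V} {u v x y : V}

lemma exists_mem_branch (hT : T.Connected) (hyx : y ≠ x) :
    ∃ w, T.Adj x w ∧ y ∈ branch T x w := by
  refine (mem_of_connected hT (C := {y | y = x ∨ ∃ w, T.Adj x w ∧ y ∈ branch T x w})
    (Or.inl rfl) ?_ y).resolve_left hyx
  intro a ha b hab
  by_cases hbx : b = x
  · exact Or.inl hbx
  · rcases ha with rfl | ⟨w, hw, ha⟩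
    · exact Or.inr ⟨b, hab, mem_branch_self hbx⟩
    · exact Or.inr ⟨w, hw, mem_branch_of_adj ha hab hbx⟩

lemma exists_isHub_of_branch [Finite V] (hT : T.IsAcyclic) (huv : T.Adj u v)
    (hx : x ∈ branch T u v) (hxX : x ∈ X) (hxv : x ≠ v) : ∃ u v, IsHub T X u v := by
  induction hn : (branch T u v).ncard using Nat.strong_induction_on generalizing u v x with
  | _ n ih =>
    by_cases hdeep : ∃ w y, T.Adj v w ∧ w ≠ u ∧ y ∈ branch T v w ∧ y ∈ X ∧ y ≠ w
    · obtain ⟨w, y, hvw, hwu, hy, hyX, hyw⟩ := hdeep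
      refine ih _ ?_ hvw hy hyX hyw rfl
      rw [← hn]
      exact Set.ncard_lt_ncard (branch_ssubset_branch hT huv hvw hwu)
    · push Not at hdeep
      have hnear : ∀ y ∈ branch T u v, y ∈ X → y ≠ v → T.Adj v y ∧ y ≠ u := by
        intro y hy hyX hyv
        obtain ⟨w, hw, hwu, hyw⟩ := (eq_or_exists_mem_branch hy).resolve_left hyv
        obtain rfl := hdeep w y hw hwu hyw hyX
        exact ⟨hw, hwu⟩
      obtain ⟨hvx, hxu⟩ := hnear x hx hxX hxv
      exact ⟨u, v, hT, huv, fun y hy hyX => or_iff_not_imp_left.2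
        fun hyv => (hnear y hy hyX hyv).1,
        x, ⟨hvx, hxX⟩, hxu⟩

lemma exists_subset_pair_of_not_exists_isHub [Finite V] [Nontrivial V] (hT : T.IsTree)
    (hno : ¬ ∃ u v, IsHub T X u v) (x : V) : ∃ y, T.Adj x y ∧ X ⊆ {x, y} := by
  have hadj : ∀ {a b}, b ∈ X → b ≠ a → T.Adj a b := fun {a b} hb hba => by
    obtain ⟨w, haw, hbw⟩ := exists_mem_branch hT.connected hba
    obtain rfl : b = w := by
      by_contra hbw'
      exact hno (exists_isHub_of_branch hT.isAcyclic haw hbw hb hbw')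
    exact haw
  by_cases h : ∃ y ∈ X, y ≠ x
  · obtain ⟨y, hy, hyx⟩ := h
    refine ⟨y, hadj hy hyx, fun z hz => ?_⟩
    by_contra hne
    obtain ⟨hzx, hzy⟩ := not_or.1 hne
    exact isIndepSet_neighborSet hT.isAcyclic x (hadj hy hyx) (hadj hz hzx) (Ne.symm hzy)
      (hadj hz hzy)
  · push Not at h
    obtain ⟨y, hxy⟩ := hT.connected.preconnected.exists_adj_of_nontrivial x
    exact ⟨y, hxy, fun z hz => Or.inl (h z hz)⟩

lemma IsHub.isEndvertex_of_adj {w : V} (hH : IsHub T X u v)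
    (hnear : ∀ x ∈ branch T u v, x = v ∨ T.Adj v x) (hvw : T.Adj v w) (hwu : w ≠ u) :
    IsEndvertex T v w := by
  refine ⟨hvw.symm, fun y hwy => ?_⟩
  have hy := mem_branch_of_adj_of_ne hH.acyclic hH.adj (hH.mem_of_adj hvw hwu) hvw.ne' hwy
  exact (hnear y hy).resolve_right fun hvy =>
    isIndepSet_neighborSet hH.acyclic v hvw hvy hwy.ne hwy

variable [Fintype V]

lemma one_le_weight_of_isWRDF {g : V → ℕ} (hg : IsWRDF T X g) (hx : x ∈ X) : 1 ≤ weight g := by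
  by_contra h0
  have h : ∀ a, g a = 0 := by simpa [weight] using h0
  obtain ⟨y, -, hy⟩ := hg.exists_adj_pos hx (h x)
  exact Nat.one_le_iff_ne_zero.1 hy (h y)

lemma not_strong_of_subset_pair (hx : x ∈ X) (hxy : T.Adj x y) (hX : X ⊆ {x, y}) :
    ¬ Strong T X := fun hS => by
  classical
  have hsingle : ∀ a, (Pi.single y 1 : V → ℕ) a ≤ 1 := fun a => by
    rw [Pi.single_apply]
    split_ifs <;> omega
  have hW : IsWRDF T X (Pi.single y 1) := by
    refine ⟨fun a => mem_zero_one_two_iff.2 ((hsingle a).trans one_le_two), fun a ha ha0 => ?_⟩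
    obtain rfl : a = x := (hX ha).resolve_right (by rintro rfl; simp at ha0)
    refine isDefended_iff.2 ⟨y, hxy, by simp, fun b hb => ⟨a, ?_, Or.inl rfl⟩⟩
    exact (hX hb).imp Eq.symm fun h : b = y => h ▸ hxy.symm
  have hmin : IsMinWRDF T X (Pi.single y 1) := hW.isMinWRDF fun h hh => by
    rw [weight, Finset.sum_pi_single', if_pos (Finset.mem_univ y)]
    exact one_le_weight_of_isWRDF hh hx
  obtain ⟨a, -, ha⟩ := (hS _ hmin).2 x hx (Pi.single_eq_of_ne hxy.ne 1)
  have := hsingle a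
  omega

lemma exists_isHub [Nontrivial V] (hT : T.IsTree) (hS : Strong T X) (hX : X.Nonempty) :
    ∃ u v, IsHub T X u v := by
  by_contra hno
  obtain ⟨x, hx⟩ := hX
  obtain ⟨y, hxy, hXxy⟩ := exists_subset_pair_of_not_exists_isHub hT hno x
  exact not_strong_of_subset_pair hx hxy hXxy hS

end Search

section Endvertex

variable {V : Type*} [Finite V] {T : SimpleGraph V} {u v x : V}

lemma exists_isEndvertex (hT : T.IsAcyclic) {p z : V} (hpz : T.Adj p z) :
    ∃ q y, IsEndvertex T q y ∧ (q = p ∨ q ∈ branch T p z) := by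
  induction hn : (branch T p z).ncard using Nat.strong_induction_on generalizing p z with
  | _ n ih =>
    by_cases hz : ∃ w, T.Adj z w ∧ w ≠ p
    · obtain ⟨w, hzw, hwp⟩ := hz
      have hss := branch_ssubset_branch hT hpz hzw hwp
      obtain ⟨q, y, hy, hq⟩ := ih _ (hn ▸ Set.ncard_lt_ncard hss) hzw rfl
      refine ⟨q, y, hy, Or.inr ?_⟩
      rcases hq with rfl | hq
      exacts [mem_branch_self hpz.ne', hss.subset hq]
    · push Not at hz
      exact ⟨p, z, ⟨hpz.symm, hz⟩, Or.inl rfl⟩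

lemma exists_isEndvertex_of_branch (hT : T.IsAcyclic) (huv : T.Adj u v) (hx : x ∈ branch T u v)
    (hxv : x ≠ v) (hvx : ¬ T.Adj v x) :
    ∃ p z, IsEndvertex T p z ∧ p ∈ branch T u v ∧ p ≠ v := by
  obtain ⟨w, hvw, hwu, hxw⟩ := (eq_or_exists_mem_branch hx).resolve_left hxv
  obtain ⟨y, hwy, hyv⟩ : ∃ y, T.Adj w y ∧ y ≠ v := by
    by_contra! hno
    have hsub : branch T v w ⊆ {w} := branch_subset rfl fun a ha b hab hbv =>
      absurd (hno b (Set.mem_singleton_iff.1 ha ▸ hab)) hbv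
    exact hvx (hsub hxw ▸ hvw)
  obtain ⟨p, z, hz, hp⟩ := exists_isEndvertex hT hwy
  have hpw : p ∈ branch T v w := by
    rcases hp with rfl | hp
    · exact mem_branch_self hvw.ne'
    · exact branch_subset_branch hT hvw hwy hyv hp
  exact ⟨p, z, hz, branch_subset_branch hT huv hvw hwu hpw, ne_of_mem_branch hpw⟩

end Endvertex

section Backward

variable {A B : Triple.{u}}

lemma isAdmissible_of_mem_setS (hA : A ∈ setS) : A.IsAdmissible :=
  ⟨hA.1, hA.2.2 ▸ subset_coverable _ _⟩

lemma Y_eq_of_mem_setS {Y : Set B.V} (hB : B ∈ setS)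
    (h : (⟨B.V, B.fintypeV, B.T, B.X, Y⟩ : Triple.{u}) ∈ setS) : B.Y = Y :=
  hB.2.2.trans h.2.2.symm

/-- `B` arises by one of the operations from a triple in `𝒮` with fewer vertices. -/
def IsReducible (B : Triple.{u}) : Prop :=
  ∃ A ∈ setS.{u}, Fintype.card A.V < Fintype.card B.V ∧
    (Op1 A B ∨ Op2 A B ∨ Op3 A B ∨ Op4 A B ∨ Op5 A B)

section Leaf

variable {u v p z : B.V}

lemma exists_leaf_removal (hT : B.T.IsTree) (hS : Strong B.T (B.X \ {z}))
    (hz : IsEndvertex B.T p z) :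
    ∃ A ∈ setS.{u}, Fintype.card A.V < Fintype.card B.V ∧ ∃ (φ : A.V ↪ B.V) (a : A.V),
      φ a = p ∧ LeafExt A.T B.T φ a z ∧ B.X \ {z} = φ '' A.X := by
  obtain ⟨V, G, φ, a, ha, P⟩ := exists_leafExt hz
  let : Fintype V := .ofInjective φ φ.injective
  have hX : B.X \ {z} = φ '' (φ ⁻¹' (B.X \ {z})) :=
    (Set.image_preimage_eq_of_subset fun x hx =>
      not_not.1 fun hxr => hx.2 (P.eq_of_notMem x hxr)).symm
  rw [hX] at hS
  exact ⟨⟨V, _, G, φ ⁻¹' (B.X \ {z}), coverable G _⟩,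
    ⟨P.isTree hT, P.strong_of_strong hS, rfl⟩, P.card_lt, φ, a, ha, P, hX⟩

lemma exists_leaf_removal_of_notMem (hB : B ∈ setS) (hz : IsEndvertex B.T p z) (hzX : z ∉ B.X) :
    ∃ A ∈ setS.{u}, Fintype.card A.V < Fintype.card B.V ∧ ∃ (φ : A.V ↪ B.V) (a : A.V),
      φ a = p ∧ LeafExt A.T B.T φ a z ∧ B.X = φ '' A.X := by
  obtain ⟨hT, hS, -⟩ := mem_setS_iff.1 hB
  have h := exists_leaf_removal hT (by rwa [Set.sdiff_singleton_eq_self hzX]) hz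
  rwa [Set.sdiff_singleton_eq_self hzX] at h

lemma isReducible_of_endvertex (hB : B ∈ setS) (hz : IsEndvertex B.T p z) (hzX : z ∉ B.X)
    (hp : p ∉ B.Y) : IsReducible B := by
  obtain ⟨A, hA, hcard, φ, u, rfl, P, hX⟩ := exists_leaf_removal_of_notMem hB hz hzX
  obtain ⟨-, hS, hY⟩ := mem_setS_iff.1 hB
  have hYA := (mem_setS_iff.1 hA).2.2
  rw [hX] at hS hY
  have hu : u ∉ coverable A.T A.X := by rwa [hY, P.apply_mem_coverable_iff hS] at hp
  refine ⟨A, hA, hcard, Or.inl ⟨isAdmissible_of_mem_setS hA, φ, u, z, hYA ▸ hu,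
    P.arisesByAdding, hX, ?_⟩⟩
  rw [hY, hYA]
  refine P.coverable_eq_of_never_two hS fun g hg => ?_
  simp [apply_eq_zero_of_notMem_coverable hg hu]

lemma isReducible_of_hub_neighbor (hB : B ∈ setS) (hH : IsHub B.T B.X u v)
    (hz : IsEndvertex B.T p z) (hzX : z ∉ B.X) (hvp : B.T.Adj v p) (hpu : p ≠ u) (hzv : z ≠ v) :
    IsReducible B := by
  obtain ⟨A, hA, hcard, φ, a, rfl, P, hX⟩ := exists_leaf_removal_of_notMem hB hz hzX
  obtain ⟨-, hS, hY⟩ := mem_setS_iff.1 hB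
  obtain ⟨-, hSA, hYA⟩ := mem_setS_iff.1 hA
  have hzu : z ≠ u := by rintro rfl; exact hvp.ne (hz.eq_of_adj v hH.adj)
  obtain ⟨u, rfl⟩ := (P.eq_or_exists u).resolve_left hzu.symm
  obtain ⟨v, rfl⟩ := (P.eq_or_exists v).resolve_left hzv.symm
  rw [hX] at hS hY hH
  have hHA := P.isHub hH
  have hva : A.T.Adj v a := (P.adj_iff _ _).1 hvp
  have hau : a ≠ u := fun h => hpu (congrArg φ h)
  obtain ⟨k, w, hC⟩ := hHA.exists_isConfiguration hSA hYA
  obtain ⟨i, rfl⟩ := (hC.adj_iff.1 hva).resolve_left hau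
  refine ⟨A, hA, hcard, Or.inr (Or.inr (Or.inr (Or.inr ⟨isAdmissible_of_mem_setS hA, φ, u, v, k, w,
    i, z, hC, P.arisesByAdding, hX, ?_⟩)))⟩
  rw [hY, hYA]
  refine P.coverable_eq_of_never_two hS fun g hg => ?_
  simp [hHA.apply_eq_zero hSA hg (hHA.mem_of_adj hva hau) hva.ne']

lemma isReducible_of_branch (hB : B ∈ setS) (hH : IsHub B.T B.X u v) {x : B.V}
    (hx : x ∈ branch B.T u v) (hxv : x ≠ v) (hvx : ¬ B.T.Adj v x) : IsReducible B := by
  obtain ⟨-, hS, hY⟩ := mem_setS_iff.1 hB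
  obtain ⟨p, z, hz, hp, hpv⟩ := exists_isEndvertex_of_branch hH.acyclic hH.adj hx hxv hvx
  have hzb := mem_branch_of_adj_of_ne hH.acyclic hH.adj hp hpv hz.adj.symm
  have hpu : p ≠ u := ne_of_mem_branch hp
  have hzv : z ≠ v := by rintro rfl; exact hpu (hz.eq_of_adj u hH.adj.symm).symm
  have hzX : z ∉ B.X := fun h =>
    (hH.near z hzb h).elim hzv fun hvz => hpv (hz.eq_of_adj v hvz.symm).symm
  by_cases hpY : p ∈ B.Y
  · exact isReducible_of_hub_neighbor hB hH hz hzX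
      (hH.adj_of_mem_coverable hS hp hpv (hY ▸ hpY)) hpu hzv
  · exact isReducible_of_endvertex hB hz hzX hpY

lemma isReducible_of_hub_endvertex (hB : B ∈ setS) (hS : Strong B.T (B.X \ {z}))
    (hH : IsHub B.T (B.X \ {z}) u v) (hz : IsEndvertex B.T v z) (hzu : z ≠ u) :
    IsReducible B := by
  obtain ⟨A, hA, hcard, φ, a, rfl, P, hX⟩ := exists_leaf_removal hB.1 hS hz
  obtain ⟨-, hSA, hYA⟩ := mem_setS_iff.1 hA
  obtain ⟨u, rfl⟩ := (P.eq_or_exists u).resolve_left hzu.symm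
  rw [hX] at hH
  obtain ⟨k, w, hC⟩ := (P.isHub hH).exists_isConfiguration hSA hYA
  have hBX : B.X = φ '' A.X ∨ B.X = φ '' A.X ∪ {z} := by
    rw [← hX]
    grind
  have hop : ∀ Y, Y = φ '' A.Y ∪ {z} → Op4 A ⟨B.V, B.fintypeV, B.T, B.X, Y⟩ := fun Y hY =>
    ⟨isAdmissible_of_mem_setS hA, φ, u, a, k, w, z, hC, P.arisesByAdding, hBX, hY⟩
  exact ⟨A, hA, hcard, Or.inr (Or.inr (Or.inr (Or.inl
    (hop B.Y (Y_eq_of_mem_setS hB ((hop _ rfl).mem_setS hA))))))⟩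

end Leaf

section Star

variable {u v : B.V}

lemma exists_star_removal (hB : B ∈ setS) (hvu : B.T.Adj v u)
    (hL : ∀ w, B.T.Adj v w → w ≠ u → IsEndvertex B.T v w) (hN : (demands B.T B.X u v).Nontrivial) :
    ∃ A ∈ setS.{u}, Fintype.card A.V < Fintype.card B.V ∧ ∃ (φ : A.V ↪ B.V) (a : A.V),
      φ a = u ∧ StarExt A.T B.T φ a v ∧
        (Set.range φ)ᶜ = insert v (B.T.neighborSet v \ {u}) ∧ DemandExt φ a A.X B.X := by
  obtain ⟨hT, hS, -⟩ := mem_setS_iff.1 hB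
  obtain ⟨V, G, φ, a, rfl, P, hr⟩ := exists_starExt hvu hL
  let : Fintype V := .ofInjective φ φ.injective
  have D : DemandExt φ a (φ ⁻¹' B.X \ {a}) B.X := by
    refine ⟨by grind, fun x hx => ?_, by simp⟩
    by_cases hxr : x ∈ Set.range φ
    · grind
    · exact Or.inr hxr
  have hN' : (demandingLeaves φ v B.X).Nontrivial := by
    rw [demandingLeaves_eq_inter hr (by simp)]
    refine hN.mono ?_
    grind [demands]
  exact ⟨⟨V, _, G, φ ⁻¹' B.X \ {a}, coverable G _⟩,
    ⟨P.isTree hT, P.strong_of_strong D hN' hS, rfl⟩, P.card_lt, φ, a, rfl, P, hr, D⟩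

variable {φ : A.V ↪ B.V} {a : A.V} {w₁ w₂ w₃ z : B.V}

lemma isReducible_of_star_pair (hA : A ∈ setS) (hB : B ∈ setS)
    (hcard : Fintype.card A.V < Fintype.card B.V) (P : StarExt A.T B.T φ a v)
    (D : DemandExt φ a A.X B.X) (hr : (Set.range φ)ᶜ = {v, w₁, w₂}) (hnd : [v, w₁, w₂].Nodup)
    (hX : {w₁, w₂} ⊆ B.X) : IsReducible B := by
  have hv : v ∉ ({w₁, w₂} : Set B.V) := by grind
  have hleaves : demandingLeaves φ v B.X = {w₁, w₂} := by
    rw [demandingLeaves_eq_inter hr hv, Set.inter_eq_right.2 hX]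
  obtain ⟨haX, haY⟩ :=
    P.mem_and_notMem_coverable D (hleaves ▸ Set.ncard_pair (by grind)) (mem_setS_iff.1 hB).2.1
  rw [← (mem_setS_iff.1 hA).2.2] at haY
  have hadd := P.arisesByAdding hr hv
  rw [starEdges_pair] at hadd
  have hBX : B.X = φ '' A.X ∪ {φ a, w₁, w₂} ∨ B.X = φ '' A.X ∪ {φ a, v, w₁, w₂} := by
    have := D.eq_union
    rw [hr] at this
    grind
  have hop : ∀ Y, Y = φ '' A.Y ∪ {φ a, v, w₁, w₂} → Op2 A ⟨B.V, B.fintypeV, B.T, B.X, Y⟩ :=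
    fun Y hY => ⟨isAdmissible_of_mem_setS hA, φ, a, v, w₁, w₂, haY, hnd, hadd, hBX, hY⟩
  exact ⟨A, hA, hcard, Or.inr (Or.inl
    (hop B.Y (Y_eq_of_mem_setS hB ((hop _ rfl).mem_setS hA))))⟩

lemma isReducible_of_star_triple (hA : A ∈ setS) (hB : B ∈ setS)
    (hcard : Fintype.card A.V < Fintype.card B.V) (P : StarExt A.T B.T φ a v)
    (D : DemandExt φ a A.X B.X) (hr : (Set.range φ)ᶜ = {v, w₁, w₂, w₃})
    (hnd : [v, w₁, w₂, w₃].Nodup) (hX : {w₁, w₂, w₃} ⊆ B.X) : IsReducible B := by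
  have hBX : B.X = φ '' A.X ∪ {w₁, w₂, w₃} ∨ B.X = φ '' A.X ∪ {φ a, w₁, w₂, w₃} ∨
      B.X = φ '' A.X ∪ {v, w₁, w₂, w₃} ∨ B.X = φ '' A.X ∪ {φ a, v, w₁, w₂, w₃} := by
    have hBX := D.eq_union
    rw [hr] at hBX
    by_cases ha : φ a ∈ B.X <;> by_cases hv : v ∈ B.X
    · exact Or.inr (Or.inr (Or.inr (by grind)))
    · exact Or.inr (Or.inl (by grind))
    · exact Or.inr (Or.inr (Or.inl (by grind)))
    · exact Or.inl (by grind)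
  have hadd := P.arisesByAdding hr (by grind)
  rw [starEdges_triple] at hadd
  have hop : ∀ Y, Y = φ '' A.Y ∪ {φ a, v, w₁, w₂, w₃} →
      Op3 A ⟨B.V, B.fintypeV, B.T, B.X, Y⟩ := fun Y hY =>
    ⟨isAdmissible_of_mem_setS hA, φ, a, v, w₁, w₂, w₃, D.notMem, hnd, hadd, hBX, hY⟩
  exact ⟨A, hA, hcard, Or.inr (Or.inr (Or.inl
    (hop B.Y (Y_eq_of_mem_setS hB ((hop _ rfl).mem_setS hA)))))⟩

lemma isReducible_of_three_lt_ncard (hB : B ∈ setS) (hH : IsHub B.T B.X u v)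
    (hL : ∀ w, B.T.Adj v w → w ≠ u → IsEndvertex B.T v w) (hN : 3 < (demands B.T B.X u v).ncard) :
    IsReducible B := by
  obtain ⟨A, -, -, φ, a, rfl, P, hr, D⟩ := exists_star_removal hB hH.adj.symm hL
    (Set.one_lt_ncard_iff_nontrivial.1 (by omega))
  obtain ⟨z, hz⟩ := hH.demands_nonempty
  have hcard : 2 < (demands B.T (B.X \ {z}) (φ a) v).ncard := by
    have := Set.ncard_sdiff_singleton_add_one hz
    have hd : demands B.T (B.X \ {z}) (φ a) v = demands B.T B.X (φ a) v \ {z} := by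
      grind [demands]
    rw [hd]
    omega
  have hleaves : demandingLeaves φ v (B.X \ {z}) = demands B.T (B.X \ {z}) (φ a) v := by
    rw [demandingLeaves_eq_inter hr (by simp)]
    grind [demands]
  have hzr : z ∉ Set.range φ := hr.superset (Or.inr ⟨hz.1.1, hz.2⟩)
  refine isReducible_of_hub_endvertex hB
    (P.strong_sdiff_singleton D hzr (hleaves ▸ hcard) (mem_setS_iff.1 hB).2.1) ?_
    (hL z hz.1.1 hz.2) hz.2
  exact ⟨hH.acyclic, hH.adj, fun x hx hxX => hH.near x hx hxX.1,
    Set.nonempty_of_ncard_ne_zero (by omega)⟩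

lemma isReducible_of_star (hB : B ∈ setS) (hH : IsHub B.T B.X u v)
    (hL : ∀ w, B.T.Adj v w → w ≠ u → IsEndvertex B.T v w)
    (hX : B.T.neighborSet v \ {u} ⊆ B.X) : IsReducible B := by
  have hd : demands B.T B.X u v = B.T.neighborSet v \ {u} := by grind [demands]
  have hS := (mem_setS_iff.1 hB).2.1
  obtain ⟨g, hg⟩ := exists_isMinWRDF B.T B.X
  have hN := hS.nontrivial_demands hg (hH.apply_eq_two hS hg) u
  obtain ⟨A, hA, hcard, φ, a, rfl, P, hr, D⟩ := exists_star_removal hB hH.adj.symm hL hN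
  have hvL : v ∉ B.T.neighborSet v \ {φ a} := by simp
  have h1 := Set.one_lt_ncard_iff_nontrivial.2 hN
  rw [hd] at h1
  obtain h2 | h3 | h4 : (B.T.neighborSet v \ {φ a}).ncard = 2 ∨
      (B.T.neighborSet v \ {φ a}).ncard = 3 ∨ 3 < (B.T.neighborSet v \ {φ a}).ncard := by omega
  · obtain ⟨w₁, w₂, h12, hw⟩ := Set.ncard_eq_two.1 h2
    rw [hw] at hr hX hvL
    exact isReducible_of_star_pair hA hB hcard P D hr (by grind) hX
  · obtain ⟨w₁, w₂, w₃, h12, h13, h23, hw⟩ := Set.ncard_eq_three.1 h3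
    rw [hw] at hr hX hvL
    exact isReducible_of_star_triple hA hB hcard P D hr (by grind) hX
  · exact isReducible_of_three_lt_ncard hB hH hL (hd ▸ h4)

end Star

lemma isReducible_of_mem_setS [Nontrivial B.V] (hB : B ∈ setS) : IsReducible B := by
  obtain ⟨hT, hS, hY⟩ := mem_setS_iff.1 hB
  rcases B.X.eq_empty_or_nonempty with hX | hX
  · obtain ⟨x, y, hxy⟩ : ∃ x y, B.T.Adj x y :=
      ⟨_, hT.connected.preconnected.exists_adj_of_nontrivial (Classical.arbitrary B.V)⟩
    obtain ⟨p, z, hz, -⟩ := exists_isEndvertex hT.isAcyclic hxy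
    exact isReducible_of_endvertex hB hz (by simp [hX]) (by simp [hY, hX, coverable_empty])
  obtain ⟨u, v, hH⟩ := exists_isHub hT hS hX
  by_cases hnear : ∀ x ∈ branch B.T u v, x = v ∨ B.T.Adj v x
  swap
  · push Not at hnear
    obtain ⟨x, hx, hxv, hvx⟩ := hnear
    exact isReducible_of_branch hB hH hx hxv hvx
  have hL : ∀ w, B.T.Adj v w → w ≠ u → IsEndvertex B.T v w := fun w hvw hwu =>
    hH.isEndvertex_of_adj hnear hvw hwu
  by_cases hsub : B.T.neighborSet v \ {u} ⊆ B.X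
  · exact isReducible_of_star hB hH hL hsub
  · obtain ⟨z, ⟨hvz, hzu⟩, hzX⟩ := Set.not_subset.1 hsub
    have hd : B.X \ {z} = B.X := Set.sdiff_singleton_eq_self hzX
    exact isReducible_of_hub_endvertex hB (hd.symm ▸ hS) (hd.symm ▸ hH) (hL z hvz hzu) hzu

lemma generated_of_subsingleton [Subsingleton B.V] (hB : B ∈ setS) : Generated B := by
  obtain ⟨hT, -, hY⟩ := mem_setS_iff.1 hB
  have := hT.connected.nonempty
  have h1 : Fintype.card B.V = 1 :=
    (Fintype.card_le_one_iff_subsingleton.2 ‹_›).antisymm Fintype.card_pos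
  rcases B.X.eq_empty_or_nonempty with hX | hX
  · exact .base_empty B h1 hX (by rw [hY, hX, coverable_empty])
  · have hX' := hX.eq_univ
    refine .base_full B h1 hX' ?_
    rw [hY, ← Set.univ_subset_iff, ← hX']
    exact subset_coverable _ _

lemma generated_of_mem_setS (hB : B ∈ setS) : Generated B := by
  induction hn : Fintype.card B.V using Nat.strong_induction_on generalizing B with
  | _ n ih =>
    rcases subsingleton_or_nontrivial B.V with _ | _
    · exact generated_of_subsingleton hB
    · obtain ⟨A, hA, hlt, hop⟩ := isReducible_of_mem_setS hB
      exact .step A B (ih _ (hn ▸ hlt) hA rfl) hop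

end Backward

end RomanTrees

theorem theorem2 :
    RomanTrees.setS.{u} = RomanTrees.setT.{u} ∧
      ∀ (V : Type u) [inst : Fintype V] (T : SimpleGraph V), T.IsTree →
        (RomanTrees.StronglyEqual T ↔
          (⟨V, inst, T, Set.univ, Set.univ⟩ : RomanTrees.Triple.{u}) ∈ RomanTrees.setT.{u}) := by
  have h : RomanTrees.setS.{u} = RomanTrees.setT.{u} :=
    Set.ext fun _ => ⟨RomanTrees.generated_of_mem_setS, RomanTrees.Generated.mem_setS⟩
  refine ⟨h, fun V _ T hT => ?_⟩
  rw [← h, RomanTrees.mem_setS_iff]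
  exact ⟨fun hS => ⟨hT, hS, (Set.univ_subset_iff.1 (RomanTrees.subset_coverable T _)).symm⟩,
    fun hS => hS.2.1⟩
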